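/- Let $F$ be a field of characteristic $\neq 2$ and let $A$ be a finite-dimensional central simple $F$-algebra of degree $\sqrt{\dim_F A}=2m$ and exponent $2$ (the class of $A$ in $\mathrm{Br}(F)$ has order exactly $2$). Let $\mathrm{\acute et}_m(A)$ be the moduli space of étale subalgebras of $A$ of type $[2,\dots,2]$ ($m$ entries): its points with values in a commutative $F$-algebra $R$ are the $R$-subalgebras $E\subset A_R=R\otimes_F A$ that are commutative and étale over $R$ and such that, for every homomorphism from $R$ to an algebraically closed field $\Omega\supseteq F$, the image of $\Omega\otimes_R E$ in $A_\Omega$ is $\bigoplus_{i=1}^m \Omega e_i$ with nonzero orthogonal idempotents $e_i$, $\sum_i e_i=1$, each of reduced rank $\dim_\Omega(e_iA_\Omega)/\deg A=2$. Then every nonempty open subvariety $U\subset \mathrm{\acute et}_m(A)$ is R-trivial: the set $U(F)/R$ has exactly one element. Here $R$-equivalence on $U(F)$ is the equivalence relation generated by elementary linkage, where $p_1,p_2\in U(F)$ are elementarily linked if there is a rational map $\phi:\mathbb P^1_F\dashrightarrow U$ over $F$ such that $p_1$ and $p_2$ both lie in the image of the $F$-points of the domain of $\phi$. (Open subvarieties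 of $\mathrm{\acute et}_m(A)$ are understood through their functors of points, as open subfunctors.) -/

import Mathlib

open CategoryTheory AlgebraicGeometry
open scoped TensorProduct

universe u

noncomputable section

/-! ### Central simple algebras -/

section CentralSimple

variable (F : Type*) [Field F] (A : Type*) [Ring A] [Algebra F A]

/-- The degree of a central simple algebra: the square root of its dimension. -/
def csaDegree : ℕ := Nat.sqrt (Module.finrank F A)

/-- A central simple algebra is split, i.e. trivial in the Brauer group, if it is isomorphic to
a matrix algebra over the ground field. -/
def IsSplitAlgebra : Prop := ∃ k : ℕ, k ≠ 0 ∧ Nonempty (A ≃ₐ[F] Matrix (Fin k) (Fin k) F)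

/-- A central simple algebra has exponent `2` if its Brauer class has order exactly `2`:
the class of `A` is not trivial, and twice this class, the class of `A ⊗ A`, is. -/
def HasExponentTwo : Prop := ¬ IsSplitAlgebra F A ∧ IsSplitAlgebra F (A ⊗[F] A)

/-- The reduced rank of an element (used for idempotents) `e` of a central simple algebra:
the reduced dimension `dim(eA) / deg(A)` of the right ideal `eA`. -/
def reducedRank (e : A) : ℕ :=
  Module.finrank F (LinearMap.range (LinearMap.mulLeft F e)) / csaDegree F A

end CentralSimple

/-! ### Étale subalgebras of `R ⊗ A` and their type

For a commutative `F`-algebra `R`, the algebra `A_R` is `R ⊗[F] A`. -/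

section EtaleSubalgebra

variable {F : Type u} [Field F] {A : Type u} [Ring A] [Algebra F A]
variable {R S T : Type u} [CommRing R] [Algebra F R] [CommRing S] [Algebra F S]
  [CommRing T] [Algebra F T]

/-- The canonical map `A_R → A_S` induced by `f : R → S`. -/
def extMap (A : Type u) [Ring A] [Algebra F A] (f : R →ₐ[F] S) : R ⊗[F] A →ₐ[F] S ⊗[F] A :=
  Algebra.TensorProduct.map f (AlgHom.id F A)

/-- The base change of a subalgebra of `A_R` along `f : R → S`: the `S`-subalgebra of `A_S`
generated by (equivalently, the `S`-span of, or the image of `S ⊗_R E` in `A_S`) the image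
of `E`. -/
def extSubalgebra (f : R →ₐ[F] S) (E : Subalgebra R (R ⊗[F] A)) : Subalgebra S (S ⊗[F] A) :=
  Algebra.adjoin S (extMap A f '' (E : Set (R ⊗[F] A)))

/-- `E` is a commutative étale subalgebra of `A_R`. -/
def IsEtaleSubalgebra (E : Subalgebra R (R ⊗[F] A)) : Prop :=
  ∃ (B : Type u) (_ : CommRing B) (_ : Algebra R B), Algebra.Etale R B ∧ Nonempty (B ≃ₐ[R] E)

/-- `E` has type `ρ` if at every geometric point `Spec Ω → Spec R` the algebra `E_Ω ⊆ A_Ω` is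
the direct sum of the lines spanned by orthogonal idempotents of sum `1` (its minimal
idempotents), and `ρ` is the unordered collection of their reduced ranks. -/
def HasType (E : Subalgebra R (R ⊗[F] A)) (ρ : Multiset ℕ) : Prop :=
  ∀ (Ω : Type u) [Field Ω] [Algebra F Ω] [IsAlgClosed Ω] (x : R →ₐ[F] Ω),
    ∃ (k : ℕ) (e : Fin k → Ω ⊗[F] A),
      CompleteOrthogonalIdempotents e ∧ (∀ i, e i ≠ 0) ∧
      Submodule.span Ω (Set.range e) = Subalgebra.toSubmodule (extSubalgebra x E) ∧
      Finset.univ.val.map (fun i => reducedRank Ω (Ω ⊗[F] A) (e i)) = ρ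

theorem extMap_tmul (f : R →ₐ[F] S) (r : R) (a : A) : extMap A f (r ⊗ₜ a) = f r ⊗ₜ a := rfl

theorem extMap_smul (f : R →ₐ[F] S) (r : R) (x : R ⊗[F] A) :
    extMap A f (r • x) = f r • extMap A f x := by
  induction x with
  | zero => simp
  | tmul s a => simp [extMap_tmul, TensorProduct.smul_tmul']
  | add x y hx hy => simp [hx, hy]

theorem extMap_id (x : R ⊗[F] A) : extMap A (AlgHom.id F R) x = x := by
  simp [extMap]

theorem extMap_comp (f : R →ₐ[F] S) (g : S →ₐ[F] T) (x : R ⊗[F] A) :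
    extMap A (g.comp f) x = extMap A g (extMap A f x) := by
  induction x with
  | zero => simp
  | tmul s a => simp [extMap_tmul]
  | add x y hx hy => simp [hx, hy]

theorem extSubalgebra_id (E : Subalgebra R (R ⊗[F] A)) :
    extSubalgebra (AlgHom.id F R) E = E := by
  have : (extMap A (AlgHom.id F R) '' (E : Set (R ⊗[F] A))) = E := by
    ext x; simp [extMap_id]
  rw [extSubalgebra, this, Algebra.adjoin_eq]

theorem extMap_mem (f : R →ₐ[F] S) {E : Subalgebra R (R ⊗[F] A)} {x : R ⊗[F] A} (hx : x ∈ E) :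
    extMap A f x ∈ extSubalgebra f E :=
  Algebra.subset_adjoin ⟨x, hx, rfl⟩

theorem extSubalgebra_comp (f : R →ₐ[F] S) (g : S →ₐ[F] T) (E : Subalgebra R (R ⊗[F] A)) :
    extSubalgebra (g.comp f) E = extSubalgebra g (extSubalgebra f E) := by
  apply le_antisymm
  · refine Algebra.adjoin_le ?_
    rintro _ ⟨x, hx, rfl⟩
    rw [extMap_comp]
    exact extMap_mem g (extMap_mem f hx)
  · refine Algebra.adjoin_le ?_
    rintro _ ⟨y, hy, rfl⟩
    refine Algebra.adjoin_induction (p := fun y _ => extMap A g y ∈ extSubalgebra (g.comp f) E)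
      ?_ ?_ ?_ ?_ hy
    · rintro _ ⟨x, hx, rfl⟩
      rw [← extMap_comp]
      exact extMap_mem _ hx
    · intro s
      rw [Algebra.algebraMap_eq_smul_one, extMap_smul, map_one]
      exact Subalgebra.smul_mem _ (one_mem _) _
    · intro x y _ _ hx hy
      rw [map_add]; exact add_mem hx hy
    · intro x y _ _ hx hy
      rw [map_mul]; exact mul_mem hx hy

theorem HasType.ext (f : R →ₐ[F] S) {E : Subalgebra R (R ⊗[F] A)} {ρ : Multiset ℕ}
    (h : HasType E ρ) : HasType (extSubalgebra f E) ρ := by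
  intro Ω _ _ _ x
  rw [← extSubalgebra_comp]
  exact h Ω (x.comp f)

/-- An étale subalgebra of `A_R` is an `R`-linear direct summand. -/
theorem exists_retraction [FiniteDimensional F A] {B : Type u} [CommRing B] [Algebra R B]
    [Algebra.Etale R B] (j : B →ₐ[R] R ⊗[F] A) (hj : Function.Injective j) :
    ∃ p : R ⊗[F] A →ₗ[R] B, ∀ b, p (j b) = b := by
  let _ : Module B (R ⊗[F] A) := Module.compHom (R ⊗[F] A) j.toRingHom
  have smul_def : ∀ (b : B) (x : R ⊗[F] A), b • x = j b * x := fun _ _ => rfl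
  have : IsScalarTower R B (R ⊗[F] A) := ⟨fun r b x => by
    rw [smul_def, smul_def, map_smul, smul_mul_assoc]⟩
  have : Module.Projective B (R ⊗[F] A) :=
    Algebra.FormallyUnramified.projective_of_restrictScalars (R := R) (S := B) (R ⊗[F] A)
  have : Module.Finite B (R ⊗[F] A) := Module.Finite.of_restrictScalars_finite R B (R ⊗[F] A)
  let T : Ideal B := LinearMap.range
    ((LinearMap.applyₗ (1 : R ⊗[F] A)) : ((R ⊗[F] A) →ₗ[B] B) →ₗ[B] B)
  obtain ⟨s, hs⟩ := (Module.projective_def (R := B) (P := R ⊗[F] A)).1 inferInstance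
  have key : (⊤ : Submodule B (R ⊗[F] A)) ≤ T • ⊤ := by
    intro m _
    have h1 : (1 : R ⊗[F] A) = (s 1).sum fun a c => c • a := by
      have := hs 1
      rw [Finsupp.linearCombination_apply] at this
      exact this.symm
    have h2 : m = (s 1).sum fun a c => c • (a * m) := by
      conv_lhs => rw [← one_mul m, h1]
      rw [Finsupp.sum_mul]
      simp only [smul_def, mul_assoc]
    rw [h2]
    refine Submodule.sum_mem _ fun a _ => Submodule.smul_mem_smul ?_ trivial
    exact ⟨(Finsupp.lapply a).comp s, rfl⟩
  obtain ⟨r, hr, hr0⟩ := Submodule.exists_sub_one_mem_and_smul_eq_zero_of_fg_of_le_smul T ⊤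
    Module.Finite.fg_top key
  have hr' : r = 0 := by
    apply hj
    have := hr0 1 trivial
    rw [smul_def, mul_one] at this
    rw [this, map_zero]
  subst hr'
  have h1 : (1 : B) ∈ T := by
    have := T.neg_mem hr
    simpa using this
  obtain ⟨p, hp⟩ := h1
  refine ⟨p.restrictScalars R, fun b => ?_⟩
  have hp' : p 1 = 1 := hp
  have : j b = b • (1 : R ⊗[F] A) := by rw [smul_def, mul_one]
  rw [LinearMap.restrictScalars_apply, this, map_smul, hp', smul_eq_mul, mul_one]

theorem IsEtaleSubalgebra.ext [FiniteDimensional F A] (f : R →ₐ[F] S)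
    {E : Subalgebra R (R ⊗[F] A)} (h : IsEtaleSubalgebra E) :
    IsEtaleSubalgebra (extSubalgebra f E) := by
  obtain ⟨B, _, _, hB, ⟨e⟩⟩ := h
  let _ : Algebra R S := f.toRingHom.toAlgebra
  have fdef : ∀ r : R, algebraMap R S r = f r := fun _ => rfl
  have hinj : Function.Injective (E.val.comp e.toAlgHom) :=
    Subtype.val_injective.comp e.injective
  obtain ⟨p, hp⟩ := exists_retraction (E.val.comp e.toAlgHom) hinj
  have : IsScalarTower F R S := IsScalarTower.of_algebraMap_eq fun k => (f.commutes k).symm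
  let extR : R ⊗[F] A →ₐ[R] S ⊗[F] A :=
    { (extMap A f : R ⊗[F] A →+* S ⊗[F] A) with
      commutes' := fun r => by
        change extMap A f (algebraMap R _ r) = algebraMap S _ (f r)
        rw [Algebra.algebraMap_eq_smul_one, extMap_smul, map_one,
          Algebra.algebraMap_eq_smul_one] }
  have extR_apply : ∀ x, extR x = extMap A f x := fun _ => rfl
  let g : S ⊗[R] B →ₐ[S] S ⊗[F] A :=
    Algebra.TensorProduct.lift (Algebra.ofId S _) (extR.comp (E.val.comp e.toAlgHom))
      (fun s b => Algebra.commutes s _)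
  have g_tmul : ∀ s b, g (s ⊗ₜ b) = s • extMap A f (e b) := fun s b => by
    rw [Algebra.smul_def]
    exact Algebra.TensorProduct.lift_tmul ..
  let c : S →ₗ[F] A →ₗ[F] S ⊗[R] B := LinearMap.mk₂ F
    (fun s a => s ⊗ₜ[R] p (1 ⊗ₜ a))
    (fun s s' a => TensorProduct.add_tmul _ _ _)
    (fun k s a => by rw [TensorProduct.smul_tmul'])
    (fun s a a' => by rw [TensorProduct.tmul_add, map_add, TensorProduct.tmul_add])
    (fun k s a => by
      have h1 : (1 : R) ⊗ₜ[F] (k • a) = (algebraMap F R k) • ((1 : R) ⊗ₜ[F] a) := by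
        rw [TensorProduct.smul_tmul', ← TensorProduct.smul_tmul, Algebra.smul_def, smul_eq_mul]
      rw [h1, map_smul, ← TensorProduct.smul_tmul, TensorProduct.smul_tmul',
        Algebra.smul_def, fdef, AlgHom.commutes, ← Algebra.smul_def])
  let θ : S ⊗[F] A →ₗ[F] S ⊗[R] B := TensorProduct.lift c
  have θ_ext : ∀ (s : S) (x : R ⊗[F] A), θ (s • extMap A f x) = s ⊗ₜ p x := by
    intro s x
    induction x with
    | zero => simp
    | tmul r a =>
      have h1 : r ⊗ₜ[F] a = r • ((1 : R) ⊗ₜ[F] a) := by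
        rw [TensorProduct.smul_tmul', smul_eq_mul, mul_one]
      rw [extMap_tmul, TensorProduct.smul_tmul', h1, map_smul, ← TensorProduct.smul_tmul]
      change (s • f r) ⊗ₜ[R] p (1 ⊗ₜ a) = _
      rw [Algebra.smul_def r s, fdef, smul_eq_mul, mul_comm]
    | add x y hx hy => rw [map_add, smul_add, map_add, hx, hy, map_add, TensorProduct.tmul_add]
  have hg : Function.Injective g := by
    have : ∀ z, θ (g z) = z := by
      intro z
      induction z with
      | zero => simp
      | tmul s b => rw [g_tmul, θ_ext]; congr 1; exact hp b
      | add x y hx hy => rw [map_add, map_add, hx, hy]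
    exact Function.LeftInverse.injective this
  have hrange : g.range = extSubalgebra f E := by
    apply le_antisymm
    · rintro _ ⟨z, rfl⟩
      induction z with
      | zero => simp
      | tmul s b =>
        change g (s ⊗ₜ b) ∈ _
        rw [g_tmul]
        exact Subalgebra.smul_mem _ (extMap_mem f (e b).2) _
      | add x y hx hy => rw [map_add]; exact add_mem hx hy
    · refine Algebra.adjoin_le ?_
      rintro _ ⟨x, hx, rfl⟩
      refine ⟨1 ⊗ₜ e.symm ⟨x, hx⟩, ?_⟩
      change g _ = _
      rw [g_tmul, one_smul, AlgEquiv.apply_symm_apply]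
  refine ⟨S ⊗[R] B, inferInstance, inferInstance, inferInstance, ⟨?_⟩⟩
  exact (AlgEquiv.ofInjective g hg).trans (Subalgebra.equivOfEq _ _ hrange)

end EtaleSubalgebra

/-! ### The moduli space of étale subalgebras -/

section Moduli

variable (F : Type u) [Field F] (A : Type u) [Ring A] [Algebra F A] [FiniteDimensional F A]

/-- The moduli space of étale subalgebras of `A` of type `ρ`, through its functor of points on
commutative `F`-algebras: its `R`-points are the étale subalgebras of `A_R` of type `ρ`. -/
def etType (ρ : Multiset ℕ) : CommAlgCat.{u} F ⥤ Type u where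
  obj R := {E : Subalgebra R (R ⊗[F] A) // IsEtaleSubalgebra E ∧ HasType E ρ}
  map f := TypeCat.ofHom fun E => ⟨extSubalgebra f.hom E.1, E.2.1.ext f.hom, E.2.2.ext f.hom⟩
  map_id R := by
    ext E : 3
    exact Subtype.ext (extSubalgebra_id E.1)
  map_comp f g := by
    ext E : 3
    exact Subtype.ext (extSubalgebra_comp f.hom g.hom E.1)

/-- The moduli space `ét_m(A)` of étale subalgebras of type `[n/m, …, n/m]` (`m` entries), where
`n` is the degree of `A`. -/
def et (m : ℕ) : CommAlgCat.{u} F ⥤ Type u :=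
  etType F A (Multiset.replicate m (csaDegree F A / m))

end Moduli

/-! ### Open subspaces, rational maps from the projective line, R-equivalence

Spaces over `F` are given by functors of points on commutative `F`-algebras. -/

section REquivalence

variable {F : Type u} [Field F]

/-- A subfunctor `U` of `P` is open if for every `R` and every `x ∈ P(R)` the locus in `Spec R`
where `x` lies in `U` is an open subscheme, the complement of `V(I)` for an ideal `I` of `R`. -/
def IsOpenSubfunctor {P : CommAlgCat.{u} F ⥤ Type u} (U : Subfunctor P) : Prop :=
  ∀ (R : CommAlgCat.{u} F) (x : P.obj R), ∃ I : Ideal R, ∀ (S : CommAlgCat.{u} F) (f : R ⟶ S),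
    P.map f x ∈ U.obj S ↔ I.map (f.hom : R →+* S) = ⊤

/-- A functor of points is nonempty if it has a point with values in some nonzero algebra. -/
def IsNonemptySpace (P : CommAlgCat.{u} F ⥤ Type u) : Prop :=
  ∃ R : CommAlgCat.{u} F, Nontrivial R ∧ Nonempty (P.obj R)

/-- The functor of points of an `F`-scheme. -/
def pointsOf (X : Over (Spec (CommRingCat.of F))) : CommAlgCat.{u} F ⥤ Type u :=
  (algSpec (CommRingCat.of F)).rightOp ⋙ yoneda.obj X

attribute [local instance] MvPolynomial.gradedAlgebra

variable (F) in
/-- The projective line over `F`. -/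
def projLine : Over (Spec (CommRingCat.of F)) :=
  Over.mk (Proj.toSpecZero (MvPolynomial.homogeneousSubmodule (Fin 2) F) ≫
    Spec.map (CommRingCat.ofHom
      (algebraMap F (MvPolynomial.homogeneousSubmodule (Fin 2) F 0))))

/-- An open subscheme of an `F`-scheme, as an `F`-scheme. -/
def openOver (X : Over (Spec (CommRingCat.of F))) (W : X.left.Opens) :
    Over (Spec (CommRingCat.of F)) :=
  Over.mk (W.ι ≫ X.hom)

/-- Two rational points of `P` are elementarily linked if both lie in the image of the rational
points of the domain of definition `W` of a rational map `φ` from the projective line to `P`.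
(For `P` the functor of points of a scheme, `φ` is a morphism from `W` to this scheme.) -/
def ElementarilyLinked (P : CommAlgCat.{u} F ⥤ Type u) (p q : P.obj (CommAlgCat.of F F)) : Prop :=
  ∃ (W : (projLine F).left.Opens) (φ : pointsOf (openOver (projLine F) W) ⟶ P)
    (a b : (pointsOf (openOver (projLine F) W)).obj (CommAlgCat.of F F)),
    φ.app _ a = p ∧ φ.app _ b = q

/-- The set `P(F)/R` of rational points modulo the equivalence relation generated by being
elementarily linked. -/
def RClasses (P : CommAlgCat.{u} F ⥤ Type u) : Type u := Quot (ElementarilyLinked P)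

/-- `P` is R-trivial if `P(F)/R` has exactly one element. -/
def IsRTrivial (P : CommAlgCat.{u} F ⥤ Type u) : Prop := Nat.card (RClasses P) = 1

end REquivalence

end

/-!
The idea is that the subalgebras of type `[2, …, 2]` are parametrized by an open subset of an affine
space, so that two rational points of an open subspace are joined by the image of a line.

Let `A` have degree `2m`. Since `A ⊗ A` is split, `A` has an anti-endomorphism `τ`
(`exists_antihom`), and over an algebraic closure `τ` has the form `x ↦ b xᵀ b⁻¹`. Adjusting it by
an element `g` of `A` which becomes `b (bᵀ)⁻¹` over the closure (`exists_antihom_splitting`)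
gives two linear maps `ℓ₁, ℓ₂ : A → A` whose kernels are forms of the space of skew-symmetric
matrices: after splitting, `x ∈ ker ℓ₁` iff `x b` is skew-symmetric and `x ∈ ker ℓ₂` iff `b⁻¹ x` is
(`exists_isSkewPair`). For `u ∈ ker ℓ₁` and `s ∈ ker ℓ₂` the product `u s` is therefore a product of
two skew-symmetric matrices over the algebraic closure, and this has two consequences.

* If `u` is invertible, the minimal polynomial of `u s` has degree at most `m`, because cyclic
  subspaces are totally isotropic (`Matrix.natDegree_minpoly_mul_skew_le`). If it is separable of
  degree `m`, then `u s` generates an étale subalgebra of type `[2, …, 2]`: the `m` idempotents `e`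
  have rank at least two since `e u b` is skew-symmetric and a skew-symmetric matrix is not of rank
  one, and the ranks add up to `2m` (`exists_idempotents_of_skew_product`).
* Conversely a subalgebra of type `[2, …, 2]` over an infinite field is generated by such a product
  (`exists_eq_adjoin_mul`): an invertible skew-symmetric matrix for which the idempotents are
  self-adjoint exists over the algebraic closure, and the conditions on it are linear apart from the
  invertibility.

The generic pair `(u, s)` has coordinates in a polynomial ring. The minimal polynomial of `u s` is
defined over this ring, as it is integrally closed, and inverting its resultant with its derivative
and the norm of `u` gives a point of the moduli space with values in a localization
`F[X₁, …, X_d]_D` which specializes to every point over an infinite field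
(`exists_generic_point`).

For a space with such a point, two rational points of an open subspace `U` come from parameters
`a` and `b`. The line through `a` and `b` gives a map to `U` from the locus in the affine line where
a polynomial not vanishing at `0` and `1` is invertible, so the points are elementarily linked
(`elementarilyLinked_of_parametrization`); and `U` has a rational point since a nonzero polynomial
does not vanish identically on an infinite field. The field `F` is infinite since central simple
algebras over finite fields are split.
-/

/-! ### Splitting over algebraically closed fields -/

/-- If `A ⊗ A` is a matrix algebra, so is `S ⊗ (A ⊗ A)`; tensoring a proper quotient of `S ⊗ A`
with `A` gives a nonzero quotient of this simple ring. -/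
theorem isSimpleRing_baseChange {F A : Type*} (S : Type*) [Field F] [Ring A] [Nontrivial A]
    [Algebra F A] [Field S] [Algebra F S] (h : IsSplitAlgebra F (A ⊗[F] A)) :
    IsSimpleRing (S ⊗[F] A) := by
  obtain ⟨k, hk, ⟨e⟩⟩ := h
  have : NeZero k := ⟨hk⟩
  let E : (S ⊗[F] A) ⊗[F] A ≃ₐ[F] Matrix (Fin k) (Fin k) S :=
    ((Algebra.TensorProduct.assoc F F F S A A).trans
      (Algebra.TensorProduct.congr AlgEquiv.refl e)).trans
      ((matrixEquivTensor (Fin k) F S).symm)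
  have hs : IsSimpleRing ((S ⊗[F] A) ⊗[F] A) :=
    IsSimpleRing.of_ringEquiv E.symm.toRingEquiv inferInstance
  rw [isSimpleRing_iff_isTwoSided_imp]
  refine ⟨inferInstance, fun I hI => ?_⟩
  by_cases htop : I = ⊤
  · exact Or.inr htop
  left
  have : Nontrivial (S ⊗[F] A ⧸ I) := Ideal.Quotient.nontrivial_iff.2 htop
  let q := Algebra.TensorProduct.map (Ideal.Quotient.mkₐ F I) (AlgHom.id F A)
  have hq : Function.Injective q := q.toRingHom.injective
  rw [eq_bot_iff]
  intro x hx
  have h1 : x ⊗ₜ[F] (1 : A) = 0 := by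
    apply hq
    rw [map_zero, Algebra.TensorProduct.map_tmul, Ideal.Quotient.mkₐ_eq_mk,
      Ideal.Quotient.eq_zero_iff_mem.2 hx, TensorProduct.zero_tmul]
  have h2 := Algebra.TensorProduct.includeLeft_injective (R := F) (S := F) (A := S ⊗[F] A) (B := A)
    (FaithfulSMul.algebraMap_injective F A)
  exact h2 (by simpa using h1)

/-- Over a simple Artinian ring, every module is isotypic of the type of any minimal left ideal. -/
theorem isIsotypicOfType_of_isSimpleModule {A : Type*} [Ring A] [IsSimpleRing A] [IsArtinianRing A]
    (S : Submodule A A) [IsSimpleModule A S] (L : Type*) [AddCommGroup L] [Module A L] :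
    IsIsotypicOfType A L S := fun m _ => by
  obtain ⟨I, ⟨e⟩⟩ := IsSemisimpleRing.exists_linearEquiv_ideal_of_isSimpleModule A m
  have := IsSimpleModule.congr e.symm
  obtain ⟨e'⟩ := IsSimpleRing.isIsotypic A A S I
  exact ⟨e.trans e'⟩

/-- Modules of the same dimension over a simple finite-dimensional algebra are isomorphic. -/
theorem nonempty_linearEquiv_of_finrank_eq {F A M N : Type*} [Field F] [Ring A]
    [Algebra F A] [FiniteDimensional F A] [IsSimpleRing A] [AddCommGroup M] [AddCommGroup N]
    [Module F M] [Module F N] [Module A M] [Module A N] [IsScalarTower F A M]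
    [IsScalarTower F A N] [FiniteDimensional F M] [FiniteDimensional F N]
    (h : Module.finrank F M = Module.finrank F N) : Nonempty (M ≃ₗ[A] N) := by
  have := IsArtinianRing.of_finite F A
  have : Module.Finite A M := Module.Finite.of_restrictScalars_finite F A M
  have : Module.Finite A N := Module.Finite.of_restrictScalars_finite F A N
  obtain ⟨S, hS⟩ := IsAtomic.exists_atom (Submodule A A)
  rw [← isSimpleModule_iff_isAtom] at hS
  have : FiniteDimensional F S := inferInstanceAs (FiniteDimensional F (S.restrictScalars F))
  obtain ⟨a, ⟨eM⟩⟩ := (isIsotypicOfType_of_isSimpleModule S M).linearEquiv_fun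
  obtain ⟨b, ⟨eN⟩⟩ := (isIsotypicOfType_of_isSimpleModule S N).linearEquiv_fun
  have hM := (eM.restrictScalars F).finrank_eq
  have hN := (eN.restrictScalars F).finrank_eq
  rw [Module.finrank_pi_fintype] at hM hN
  simp only [Finset.sum_const, Finset.card_univ, Fintype.card_fin, smul_eq_mul] at hM hN
  have : Nontrivial S := hS.nontrivial
  have hpos : 0 < Module.finrank F S := Module.finrank_pos
  have hab : a = b := Nat.eq_of_mul_eq_mul_right hpos (by rw [← hM, ← hN, h])
  subst hab
  exact ⟨eM.trans eN.symm⟩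

/-- If `A ⊗ A` is split, then `A` has an anti-endomorphism: a simple module `W` of `A ⊗ A` has
the dimension of `A`, so it is `A` as a module over the left factor, on which the right factor
acts by right multiplications. -/
theorem exists_antihom {F A : Type*} [Field F] [Ring A]
    [Algebra F A] [FiniteDimensional F A] [IsSimpleRing A] (h : IsSplitAlgebra F (A ⊗[F] A)) :
    ∃ τ : A →ₗ[F] A, (∀ a b, τ (a * b) = τ b * τ a) ∧ τ 1 = 1 := by
  obtain ⟨k, hk, ⟨e⟩⟩ := h
  have hdim : Module.finrank F A = k := by
    have := e.toLinearEquiv.finrank_eq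
    rw [Module.finrank_tensorProduct, Module.finrank_matrix] at this
    simp only [Fintype.card_fin, Module.finrank_self, mul_one] at this
    exact Nat.mul_self_inj.1 this
  let E : A ⊗[F] A →ₐ[F] Module.End F (Fin k → F) :=
    (Matrix.toLinAlgEquiv' : Matrix (Fin k) (Fin k) F ≃ₐ[F] _).toAlgHom.comp e.toAlgHom
  let E₁ : A →ₐ[F] Module.End F (Fin k → F) := E.comp Algebra.TensorProduct.includeLeft
  let _ : Module A (Fin k → F) := Module.compHom _ E₁.toRingHom
  have smul_def : ∀ (a : A) (w : Fin k → F), a • w = E (a ⊗ₜ 1) w := fun _ _ => rfl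
  have : IsScalarTower F A (Fin k → F) := ⟨fun r a w => by
    rw [smul_def, smul_def, ← TensorProduct.smul_tmul', map_smul, LinearMap.smul_apply]⟩
  obtain ⟨f⟩ := nonempty_linearEquiv_of_finrank_eq (F := F) (A := A) (M := A) (N := Fin k → F)
    (by simpa using hdim)
  have comm : ∀ (a b : A) (w : Fin k → F), E (1 ⊗ₜ b) (a • w) = a • E (1 ⊗ₜ b) w := fun a b w => by
    rw [smul_def, smul_def, ← Module.End.mul_apply, ← Module.End.mul_apply, ← map_mul, ← map_mul,
      Algebra.TensorProduct.tmul_mul_tmul, Algebra.TensorProduct.tmul_mul_tmul]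
    simp
  let τ : A →ₗ[F] A := (f.symm.restrictScalars F).toLinearMap.comp
    ((LinearMap.applyₗ (f 1)).comp
      (E.toLinearMap.comp (Algebra.TensorProduct.includeRight : A →ₐ[F] A ⊗[F] A).toLinearMap))
  have hτ : ∀ b, f (τ b) = E (1 ⊗ₜ b) (f 1) := fun b => f.apply_symm_apply _
  refine ⟨τ, fun a b => f.injective ?_, f.injective ?_⟩
  · have h1 : (1 : A) ⊗ₜ[F] (a * b) = 1 ⊗ₜ a * 1 ⊗ₜ b := by simp
    rw [hτ, h1, map_mul, Module.End.mul_apply, ← hτ b]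
    conv_lhs => rw [← mul_one (τ b), ← smul_eq_mul, map_smul, comm, ← hτ, ← map_smul]
    rfl
  · rw [hτ, ← Algebra.TensorProduct.one_def, map_one, Module.End.one_apply]

/-- An algebra homomorphism from a central simple algebra to matrices of its degree extends to a
splitting. -/
theorem exists_algEquiv_of_algHom {F A Ω : Type*} [Field F] [Ring A] [Algebra F A]
    [FiniteDimensional F A] [Nontrivial A] [Field Ω] [Algebra F Ω]
    (hs : IsSplitAlgebra F (A ⊗[F] A)) {n : ℕ} (hn : n ≠ 0) (hdim : Module.finrank F A = n * n)
    (ρ : A →ₐ[F] Matrix (Fin n) (Fin n) Ω) :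
    ∃ ψ : Ω ⊗[F] A ≃ₐ[Ω] Matrix (Fin n) (Fin n) Ω, ∀ r a, ψ (r ⊗ₜ a) = r • ρ a := by
  have := isSimpleRing_baseChange Ω hs
  have : NeZero n := ⟨hn⟩
  let f : Ω ⊗[F] A →ₐ[Ω] Matrix (Fin n) (Fin n) Ω :=
    Algebra.TensorProduct.lift (Algebra.ofId Ω _) ρ (fun r _ => Algebra.commutes r _)
  have hf : Function.Injective f := f.toRingHom.injective
  refine ⟨AlgEquiv.ofBijective f ⟨hf, ?_⟩, fun r a => ?_⟩
  · refine (LinearMap.injective_iff_surjective_of_finrank_eq_finrank (f := f.toLinearMap) ?_).1 hf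
    rw [Module.finrank_baseChange, hdim, Module.finrank_matrix]
    simp
  · rw [Algebra.smul_def]
    exact Algebra.TensorProduct.lift_tmul (Algebra.ofId Ω _) ρ
      (fun r _ => Algebra.commutes r _) r a

theorem exists_algEquiv_matrix_of_isAlgClosed {F A : Type*} (Ω : Type*) [Field F] [Ring A]
    [Algebra F A] [FiniteDimensional F A] [Nontrivial A] [Field Ω] [Algebra F Ω] [IsAlgClosed Ω]
    (hs : IsSplitAlgebra F (A ⊗[F] A)) :
    ∃ n : ℕ, n ≠ 0 ∧ csaDegree F A = n ∧ Module.finrank F A = n * n ∧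
      Nonempty (Ω ⊗[F] A ≃ₐ[Ω] Matrix (Fin n) (Fin n) Ω) := by
  have := isSimpleRing_baseChange Ω hs
  obtain ⟨n, hn, ⟨e⟩⟩ := IsSimpleRing.exists_algEquiv_matrix_of_isAlgClosed Ω (Ω ⊗[F] A)
  have hdim : Module.finrank F A = n * n := by
    have := e.toLinearEquiv.finrank_eq
    rw [Module.finrank_baseChange, Module.finrank_matrix] at this
    simpa using this
  refine ⟨n, hn.out, ?_, hdim, ⟨e⟩⟩
  rw [csaDegree, hdim, Nat.sqrt_eq]

/-- Endomorphisms of a matrix algebra are inner. -/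
theorem Matrix.exists_eq_conj_of_algHom {K : Type*} [Field K] {n : ℕ}
    (θ : Matrix (Fin n) (Fin n) K →ₐ[K] Matrix (Fin n) (Fin n) K) :
    ∃ c c' : Matrix (Fin n) (Fin n) K, c * c' = 1 ∧ c' * c = 1 ∧ ∀ x, θ x = c * x * c' := by
  rcases Nat.eq_zero_or_pos n with rfl | hn
  · exact ⟨1, 1, by simp, by simp, fun x => Subsingleton.elim _ _⟩
  have : NeZero n := ⟨hn.ne'⟩
  have hinj : Function.Injective θ := θ.toRingHom.injective
  let e : Matrix (Fin n) (Fin n) K ≃ₐ[K] Matrix (Fin n) (Fin n) K := AlgEquiv.ofBijective θ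
    ⟨hinj, (LinearMap.injective_iff_surjective (f := θ.toLinearMap)).1 hinj⟩
  let t : Matrix (Fin n) (Fin n) K ≃ₐ[K] Module.End K (Fin n → K) := Matrix.toLinAlgEquiv'
  obtain ⟨T, hT⟩ := ((t.symm.trans e).trans t).eq_linearEquivConjAlgEquiv
  refine ⟨t.symm T.toLinearMap, t.symm T.symm.toLinearMap, ?_, ?_, fun x => ?_⟩
  · rw [← map_mul, ← map_one t.symm]
    congr 1
    exact LinearMap.ext fun x => by simp
  · rw [← map_mul, ← map_one t.symm]
    congr 1
    exact LinearMap.ext fun x => by simp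
  · apply t.injective
    rw [map_mul, map_mul, t.apply_symm_apply, t.apply_symm_apply]
    have := DFunLike.congr_fun hT (t x)
    have h : t (e x) = T.toLinearMap ∘ₗ t x ∘ₗ T.symm.toLinearMap := by
      simpa [LinearEquiv.conjAlgEquiv_apply] using this
    change t (e x) = _
    rw [h, Module.End.mul_eq_comp, Module.End.mul_eq_comp, LinearMap.comp_assoc]

/-- A nonzero skew-symmetric matrix does not have rank one. -/
theorem Matrix.eq_zero_of_skew_of_mul_mul {K : Type*} [Field K] (h2 : (2 : K) ≠ 0) {n : ℕ}
    {s : Matrix (Fin n) (Fin n) K} (hs : s.transpose = -s)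
    (h : ∀ y, ∃ c : K, s * y * s = c • s) : s = 0 := by
  have skew : ∀ i j, s j i = - s i j := fun i j => congr_fun₂ hs i j
  have diag : ∀ i, s i i = 0 := fun i => by
    have := skew i i
    have h3 : 2 * s i i = 0 := by linear_combination this
    exact (mul_eq_zero.1 h3).resolve_left h2
  ext i j
  obtain ⟨c, hc⟩ := h (Matrix.single j i 1)
  have e : ∀ k l, s k j * s i l = c * s k l := fun k l => by
    have := congr_fun₂ hc k l
    rw [Matrix.smul_apply, smul_eq_mul] at this
    rw [← this, Matrix.mul_assoc, Matrix.mul_apply, Finset.sum_eq_single j]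
    · rw [Matrix.single_mul_apply_same]; simp
    · intro x _ hx
      rw [Matrix.single_mul_apply_of_ne _ _ _ _ _ hx, mul_zero]
    · simp
  have h1 := e i j
  have h3 := e j i
  rw [diag, zero_mul, skew i j] at h3
  have : s i j * s i j = 0 := by linear_combination h1 + h3
  simpa using this

/-! ### Slicing elements of a scalar extension -/

section Slice

variable {F : Type u} [Field F] {A : Type u} [Ring A] [Algebra F A]
variable {K L : Type u} [Field K] [Field L] [Algebra F K] [Algebra F L] [Algebra K L]
  [IsScalarTower F K L]

/-- The map `π ⊗ id : A_L → A_K` given by a `K`-linear functional `π` on `L`. -/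
noncomputable def slice (A : Type u) [Ring A] [Algebra F A] (π : L →ₗ[K] K) :
    L ⊗[F] A →ₗ[K] K ⊗[F] A :=
  TensorProduct.AlgebraTensorModule.map π (LinearMap.id : A →ₗ[F] A)

theorem slice_tmul (π : L →ₗ[K] K) (l : L) (a : A) : slice A π (l ⊗ₜ[F] a) = π l ⊗ₜ a := rfl

theorem slice_smul_extMap (π : L →ₗ[K] K) (l : L) (x : K ⊗[F] A) :
    slice A π (l • extMap A (IsScalarTower.toAlgHom F K L) x) = π l • x := by
  induction x with
  | zero => simp
  | tmul k a =>
    rw [extMap_tmul, TensorProduct.smul_tmul', slice_tmul, TensorProduct.smul_tmul']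
    congr 1
    rw [smul_eq_mul, IsScalarTower.coe_toAlgHom', mul_comm, ← Algebra.smul_def, map_smul,
      smul_eq_mul, smul_eq_mul, mul_comm]
  | add x y hx hy => simp only [map_add, smul_add, hx, hy]

theorem slice_extMap_mul (π : L →ₗ[K] K) (x : K ⊗[F] A) (z : L ⊗[F] A) :
    slice A π (extMap A (IsScalarTower.toAlgHom F K L) x * z) = x * slice A π z := by
  induction z with
  | zero => simp
  | add y z hy hz => simp only [mul_add, map_add, hy, hz]
  | tmul l a =>
    induction x with
    | zero => simp
    | add y z hy hz => simp only [map_add, add_mul, hy, hz]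
    | tmul k b =>
      rw [extMap_tmul, Algebra.TensorProduct.tmul_mul_tmul, slice_tmul, slice_tmul,
        Algebra.TensorProduct.tmul_mul_tmul, IsScalarTower.coe_toAlgHom', ← Algebra.smul_def,
        map_smul, smul_eq_mul]

theorem slice_mul_extMap (π : L →ₗ[K] K) (x : K ⊗[F] A) (z : L ⊗[F] A) :
    slice A π (z * extMap A (IsScalarTower.toAlgHom F K L) x) = slice A π z * x := by
  induction z with
  | zero => simp
  | add y z hy hz => simp only [add_mul, map_add, hy, hz]
  | tmul l a =>
    induction x with
    | zero => simp
    | add y z hy hz => simp only [map_add, mul_add, hy, hz]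
    | tmul k b =>
      rw [extMap_tmul, Algebra.TensorProduct.tmul_mul_tmul, slice_tmul, slice_tmul,
        Algebra.TensorProduct.tmul_mul_tmul, IsScalarTower.coe_toAlgHom', mul_comm,
        ← Algebra.smul_def, map_smul, smul_eq_mul, mul_comm]

theorem slice_lTensor (π : L →ₗ[K] K) (f : A →ₗ[F] A) (z : L ⊗[F] A) :
    slice A π (f.lTensor L z) = f.lTensor K (slice A π z) := by
  induction z with
  | zero => simp
  | add y z hy hz => simp only [map_add, hy, hz]
  | tmul l a => rfl

/-- Every element of `A_L` is an `L`-combination of its slices. -/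
theorem exists_eq_sum_slice (z : L ⊗[F] A) :
    ∃ (r : ℕ) (l : Fin r → L) (π : Fin r → (L →ₗ[K] K)),
      z = ∑ i, l i • extMap A (IsScalarTower.toAlgHom F K L) (slice A (π i) z) := by
  classical
  let B := Module.Basis.ofVectorSpace K L
  have key : ∃ s : Finset (Module.Basis.ofVectorSpaceIndex K L), ∀ t, s ⊆ t →
      z = ∑ i ∈ t, B i • extMap A (IsScalarTower.toAlgHom F K L) (slice A (B.coord i) z) := by
    induction z with
    | zero => exact ⟨∅, fun t _ => by simp⟩
    | add y z hy hz =>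
      obtain ⟨s, hs⟩ := hy
      obtain ⟨s', hs'⟩ := hz
      refine ⟨s ∪ s', fun t ht => ?_⟩
      simp only [map_add, smul_add, Finset.sum_add_distrib]
      rw [← hs t (Finset.union_subset_left ht), ← hs' t (Finset.union_subset_right ht)]
    | tmul l a =>
      refine ⟨(B.repr l).support, fun t ht => ?_⟩
      have h1 : ∀ i, B i • extMap A (IsScalarTower.toAlgHom F K L) (slice A (B.coord i) (l ⊗ₜ[F] a))
          = (B.repr l i • B i) ⊗ₜ[F] a := fun i => by
        rw [slice_tmul, extMap_tmul, TensorProduct.smul_tmul', smul_eq_mul, mul_comm,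
          IsScalarTower.coe_toAlgHom', ← Algebra.smul_def]
        rfl
      rw [Finset.sum_congr rfl fun i _ => h1 i, ← TensorProduct.sum_tmul]
      congr 1
      conv_lhs => rw [← B.linearCombination_repr l, Finsupp.linearCombination_apply]
      exact Finsupp.sum_of_support_subset _ ht _ (by simp)
  obtain ⟨s, hs⟩ := key
  refine ⟨s.card, fun i => B (s.equivFin.symm i), fun i => B.coord (s.equivFin.symm i), ?_⟩
  conv_lhs => rw [hs s subset_rfl, ← Finset.sum_coe_sort]
  exact (Equiv.sum_comp s.equivFin.symm fun i : s =>
    B i • extMap A (IsScalarTower.toAlgHom F K L) (slice A (B.coord i) z)).symm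

theorem extMap_injective {R S : Type u} [CommRing R] [CommRing S] [Algebra F R] [Algebra F S]
    {f : R →ₐ[F] S} (hf : Function.Injective f) : Function.Injective (extMap A f) :=
  Module.Flat.rTensor_preserves_injective_linearMap (M := A) f.toLinearMap hf

end Slice

/-! ### Forms of the space of skew-symmetric matrices -/

open Matrix in
/-- The data descending transposition: an anti-endomorphism `τ` of `A` which is
`x ↦ b xᵀ b⁻¹` in a splitting, and an element `g` of `A` which is `b (bᵀ)⁻¹` there. Then
`x b` is skew-symmetric if and only if `τ x + g x = 0`. -/
theorem exists_antihom_splitting {F A : Type u} [Field F] (h2 : (2 : F) ≠ 0) [Ring A]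
    [Algebra F A] [FiniteDimensional F A] [Algebra.IsCentral F A] [IsSimpleRing A]
    (hs : IsSplitAlgebra F (A ⊗[F] A)) {n : ℕ} (hn : n ≠ 0)
    (hdim : Module.finrank F A = n * n) (Ω : Type u) [Field Ω] [Algebra F Ω] [IsAlgClosure F Ω]
    (ψ : Ω ⊗[F] A ≃ₐ[Ω] Matrix (Fin n) (Fin n) Ω) :
    ∃ (τ : A →ₗ[F] A) (g : A) (b b' : Matrix (Fin n) (Fin n) Ω), b * b' = 1 ∧ b' * b = 1 ∧
      (∀ a, ψ (1 ⊗ₜ τ a) = b * (ψ (1 ⊗ₜ a))ᵀ * b') ∧ ψ (1 ⊗ₜ g) = b * b'ᵀ := by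
  have : IsAlgClosed Ω := IsAlgClosure.isAlgClosed F
  have : Algebra.IsAlgebraic F Ω := IsAlgClosure.isAlgebraic
  have : Normal F Ω := IsAlgClosure.normal F Ω
  have h2Ω : (2 : Ω) ≠ 0 := by
    rw [← map_ofNat (algebraMap F Ω) 2]
    exact (map_ne_zero _).2 h2
  obtain ⟨τ, hτmul, hτ1⟩ := exists_antihom hs
  let ρ : A →ₐ[F] Matrix (Fin n) (Fin n) Ω :=
    (ψ.toAlgHom.restrictScalars F).comp Algebra.TensorProduct.includeRight
  have hρ : ∀ a, ρ a = ψ (1 ⊗ₜ a) := fun _ => rfl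
  have : NeZero n := ⟨hn⟩
  have hρinj : Function.Injective ρ := ρ.toRingHom.injective
  have hψ : ∀ r a, ψ (r ⊗ₜ a) = r • ρ a := fun r a => by
    rw [hρ, ← map_smul, TensorProduct.smul_tmul', smul_eq_mul, mul_one]
  have hext : ∀ p q : Matrix (Fin n) (Fin n) Ω →ₗ[Ω] Matrix (Fin n) (Fin n) Ω,
      (∀ a, p (ρ a) = q (ρ a)) → ∀ x, p x = q x := fun p q hpq x => by
    obtain ⟨z, rfl⟩ := ψ.surjective x
    induction z with
    | zero => simp
    | add y z hy hz => simp only [map_add, hy, hz]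
    | tmul r a => rw [hψ, map_smul, map_smul, hpq]
  -- The composite of `τ` and transposition is an endomorphism of the matrix algebra, so inner.
  let ρ' : A →ₐ[F] Matrix (Fin n) (Fin n) Ω := AlgHom.ofLinearMap
    ((Matrix.transposeLinearEquiv (Fin n) (Fin n) F Ω).toLinearMap.comp (ρ.toLinearMap.comp τ))
    (by simp [hτ1]) (fun x y => by simp [hτmul])
  have hρ' : ∀ a, ρ' a = (ρ (τ a))ᵀ := fun _ => rfl
  obtain ⟨ψ', hψ'⟩ := exists_algEquiv_of_algHom hs hn hdim ρ'
  obtain ⟨c, c', hc, hc', hcc⟩ := Matrix.exists_eq_conj_of_algHom (ψ'.toAlgHom.comp ψ.symm.toAlgHom)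
  obtain ⟨b, b', rfl, rfl⟩ : ∃ b b', c = b'ᵀ ∧ c' = bᵀ := ⟨c'ᵀ, cᵀ, by simp, by simp⟩
  have hb : b * b' = 1 := by rw [← transpose_inj, transpose_mul, hc, transpose_one]
  have hb' : b' * b = 1 := by rw [← transpose_inj, transpose_mul, hc', transpose_one]
  have hb1 : ∀ x : Matrix (Fin n) (Fin n) Ω, b * (b' * x) = x := fun x => by
    rw [← Matrix.mul_assoc, hb, Matrix.one_mul]
  have hb2 : ∀ x : Matrix (Fin n) (Fin n) Ω, b' * (b * x) = x := fun x => by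
    rw [← Matrix.mul_assoc, hb', Matrix.one_mul]
  have hb3 : ∀ x : Matrix (Fin n) (Fin n) Ω, b'ᵀ * (bᵀ * x) = x := fun x => by
    rw [← Matrix.mul_assoc, hc, Matrix.one_mul]
  have hb4 : ∀ x : Matrix (Fin n) (Fin n) Ω, bᵀ * (b'ᵀ * x) = x := fun x => by
    rw [← Matrix.mul_assoc, hc', Matrix.one_mul]
  have hτρ : ∀ a, ρ (τ a) = b * (ρ a)ᵀ * b' := fun a => by
    have h1 := hcc (ρ a)
    have h3 : ψ' (ψ.symm (ρ a)) = ρ' a := by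
      rw [hρ, AlgEquiv.symm_apply_apply, hψ', one_smul]
    have h4 : ρ' a = b'ᵀ * ρ a * bᵀ := by rw [← h3]; exact h1
    rw [hρ', ← transpose_inj, transpose_transpose] at h4
    rw [h4]
    simp [transpose_mul, Matrix.mul_assoc]
  -- An element `g` with `g x = τ² x g`, found among the slices of `b (bᵀ)⁻¹`.
  let z : Ω ⊗[F] A := ψ.symm (b * b'ᵀ)
  have hz : ∀ a : A, z * (1 ⊗ₜ a) = (1 ⊗ₜ τ (τ a)) * z := fun a => by
    apply ψ.injective
    rw [map_mul, map_mul, ψ.apply_symm_apply, ← hρ, ← hρ, hτρ, hτρ]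
    simp only [transpose_mul, transpose_transpose, Matrix.mul_assoc, hb2, hc',
      Matrix.mul_one]
  have hz0 : z ≠ 0 := fun h0 => by
    have h1 : b * b'ᵀ = 0 := by
      rw [← ψ.apply_symm_apply (b * b'ᵀ)]
      exact (congrArg ψ h0).trans (map_zero ψ)
    have h3 : b' * (b * b'ᵀ) * bᵀ = 1 := by rw [hb2, hc]
    rw [h1] at h3
    simp at h3
  obtain ⟨g, hg0, hg⟩ : ∃ g : A, g ≠ 0 ∧ ∀ a, g * a = τ (τ a) * g := by
    obtain ⟨r, l, π, hsum⟩ := exists_eq_sum_slice (K := F) z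
    obtain ⟨i, hi⟩ : ∃ i, slice A (π i) z ≠ 0 := by
      by_contra! hcon
      exact hz0 (by rw [hsum]; simp [hcon])
    let e : F ⊗[F] A ≃ₐ[F] A := Algebra.TensorProduct.lid F A
    refine ⟨e (slice A (π i) z), by simpa using hi, fun a => ?_⟩
    apply e.symm.injective
    rw [map_mul, map_mul, e.symm_apply_apply]
    have h1 : ∀ a, e.symm a = 1 ⊗ₜ a := fun a => rfl
    rw [h1, h1, ← slice_mul_extMap, ← slice_extMap_mul, extMap_tmul, extMap_tmul, map_one, hz]
  -- `ρ g` is a multiple of `b (bᵀ)⁻¹` since the quotient is central.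
  have hcomm : ∀ x, bᵀ * (b' * ρ g) * x = x * (bᵀ * (b' * ρ g)) := by
    refine hext (LinearMap.mulLeft Ω (bᵀ * (b' * ρ g))) (LinearMap.mulRight Ω (bᵀ * (b' * ρ g)))
      fun a => ?_
    rw [LinearMap.mulLeft_apply, LinearMap.mulRight_apply]
    have h1 : ρ g * ρ a = b * (b'ᵀ * (ρ a * (bᵀ * (b' * ρ g)))) := by
      rw [← map_mul, hg, map_mul, hτρ, hτρ]
      simp only [transpose_mul, transpose_transpose, Matrix.mul_assoc]
    rw [Matrix.mul_assoc, Matrix.mul_assoc, h1, hb2, hb4]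
  obtain ⟨d, hd⟩ : ∃ d : Ω, bᵀ * (b' * ρ g) = algebraMap Ω _ d := by
    have : bᵀ * (b' * ρ g) ∈ Subalgebra.center Ω (Matrix (Fin n) (Fin n) Ω) :=
      Subalgebra.mem_center_iff.2 fun x => (hcomm x).symm
    rwa [Algebra.IsCentral.mem_center_iff] at this
  have hρg : ρ g = d • (b * b'ᵀ) := by
    rw [← hb1 (ρ g), ← hb3 (b' * ρ g), hd, Algebra.algebraMap_eq_smul_one]
    simp
  have hd0 : d ≠ 0 := by
    rintro rfl
    rw [zero_smul, map_eq_zero_iff _ hρinj] at hρg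
    exact hg0 hρg
  -- The square of the factor `d` is in `F` since it is the central element `τ g * g`.
  obtain ⟨q, hq⟩ : ∃ q : F, algebraMap F Ω q = d * d := by
    have h1 : ρ (τ g * g) = algebraMap Ω _ (d * d) := by
      rw [map_mul, hτρ, hρg, Algebra.algebraMap_eq_smul_one]
      simp only [transpose_smul, transpose_mul, transpose_transpose, Matrix.mul_smul,
        Matrix.smul_mul, Matrix.mul_assoc, hb1, hb2, smul_smul, hc']
    have h3 : τ g * g ∈ Subalgebra.center F A := Subalgebra.mem_center_iff.2 fun x => hρinj (by
      rw [map_mul _ x, map_mul _ _ x, h1]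
      exact (Algebra.commutes _ _).symm)
    rw [Algebra.IsCentral.mem_center_iff] at h3
    obtain ⟨q, hq⟩ := h3
    refine ⟨q, ?_⟩
    rw [hq, AlgHom.commutes, IsScalarTower.algebraMap_apply F Ω] at h1
    exact FaithfulSMul.algebraMap_injective Ω (Matrix (Fin n) (Fin n) Ω) h1
  have hτΩ : ∀ x : Ω ⊗[F] A, ψ (τ.lTensor Ω x) = b * (ψ x)ᵀ * b' := fun x => by
    induction x with
    | zero => simp
    | add y z hy hz => simp only [map_add, hy, hz, transpose_add, Matrix.mul_add, Matrix.add_mul]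
    | tmul r a => rw [LinearMap.lTensor_tmul, hψ, hψ, hτρ]; simp
  have hgΩ : ψ (1 ⊗ₜ g) = d • (b * b'ᵀ) := hρg
  -- The factor itself is in `F`: otherwise a conjugation `d ↦ -d` would turn symmetric elements
  -- of rank one into skew-symmetric ones.
  obtain ⟨f, hf⟩ : ∃ f : F, algebraMap F Ω f = d := by
    by_contra! hdF
    obtain ⟨φ, hφ⟩ : ∃ φ : Ω ≃ₐ[F] Ω, φ d = -d := by
      have hmin : minpoly F d = Polynomial.X ^ 2 - Polynomial.C q := by
        refine (minpoly.eq_of_irreducible_of_monic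
          (X_pow_sub_C_irreducible_of_prime Nat.prime_two ?_) (by simp [hq, sq])
          (Polynomial.monic_X_pow_sub_C q two_ne_zero)).symm
        rintro r rfl
        rw [sq, map_mul, mul_self_eq_mul_self_iff] at hq
        rcases hq with hq | hq
        · exact hdF r hq
        · exact hdF (-r) (by rw [map_neg, hq, neg_neg])
      have := (isConjRoot_iff_aeval_eq_zero (y := -d) (Algebra.IsIntegral.isIntegral (R := F) d)).2
        (by rw [hmin]; simp [hq, sq])
      obtain ⟨φ, hφ⟩ := isConjRoot_iff_exists_algEquiv.1 this.symm
      exact ⟨φ, hφ⟩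
    let u : Ω ⊗[F] A := ψ.symm (Matrix.single 0 0 1 * b')
    have hu : ψ u = Matrix.single 0 0 1 * b' := ψ.apply_symm_apply _
    have hsym : d • τ.lTensor Ω u = 1 ⊗ₜ g * u := by
      apply ψ.injective
      rw [map_smul, hτΩ, map_mul, hgΩ, hu]
      simp [transpose_mul, Matrix.mul_assoc]
    let ι := extMap A φ.toAlgHom
    have hι : Function.Surjective ι := fun x => ⟨extMap A φ.symm.toAlgHom x, by
      change extMap A _ (extMap A _ x) = x
      rw [← extMap_comp]
      have : φ.toAlgHom.comp φ.symm.toAlgHom = AlgHom.id F Ω := by ext x; simp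
      rw [this, extMap_id]⟩
    have hskew : (-d) • τ.lTensor Ω (ι u) = 1 ⊗ₜ g * ι u := by
      have h1 := congrArg ι hsym
      rw [extMap_smul, map_mul] at h1
      have h3 : ι (τ.lTensor Ω u) = τ.lTensor Ω (ι u) := by
        generalize u = w
        induction w with
        | zero => simp
        | add y z hy hz => simp only [map_add, hy, hz]
        | tmul r a => rfl
      have h4 : ι (1 ⊗ₜ g) = 1 ⊗ₜ g := by
        change extMap A _ _ = _
        rw [extMap_tmul, map_one]
      rw [← h3, ← hφ, ← h4]
      exact h1
    have hrank : ∀ x, ∃ r : Ω, ι u * x * ι u = r • ι u := fun x => by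
      obtain ⟨y, rfl⟩ := hι x
      obtain ⟨r, hr⟩ : ∃ r : Ω, u * y * u = r • u := by
        refine ⟨(b' * ψ y) 0 0, ψ.injective ?_⟩
        rw [map_mul, map_mul, map_smul, hu]
        have h1 := Matrix.single_mul_mul_single (0 : Fin n) (0 : Fin n) (0 : Fin n) (0 : Fin n)
          (1 : Ω) (b' * ψ y) 1
        rw [one_mul, mul_one] at h1
        have h3 : Matrix.single (0 : Fin n) (0 : Fin n) ((b' * ψ y) 0 0) =
            (b' * ψ y) 0 0 • Matrix.single (0 : Fin n) (0 : Fin n) (1 : Ω) := by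
          rw [Matrix.smul_single, smul_eq_mul, mul_one]
        rw [← Matrix.smul_mul, ← h3, ← h1]
        simp only [Matrix.mul_assoc]
      refine ⟨φ r, ?_⟩
      rw [← map_mul, ← map_mul, hr]
      exact extMap_smul _ _ _
    have hzero : ψ (ι u) * b = 0 := by
      refine Matrix.eq_zero_of_skew_of_mul_mul h2Ω ?_ fun y => ?_
      · have := congrArg ψ hskew
        rw [map_smul, hτΩ, map_mul, hgΩ] at this
        rw [neg_smul, Matrix.smul_mul, ← smul_neg] at this
        have h1 := smul_right_injective _ hd0 this
        have h3 := congrArg (fun x => bᵀ * (b' * (x * b))) h1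
        simp only [Matrix.neg_mul, Matrix.mul_neg, Matrix.mul_assoc, hb2, hb4, hb',
          Matrix.mul_one] at h3
        rw [transpose_mul, ← h3, neg_neg]
      · obtain ⟨r, hr⟩ := hrank (ψ.symm (b * y))
        refine ⟨r, ?_⟩
        have := congrArg ψ hr
        rw [map_mul, map_mul, ψ.apply_symm_apply, map_smul] at this
        rw [← Matrix.smul_mul, ← this]
        simp only [Matrix.mul_assoc]
    have h1 : ι u = 0 := by
      apply ψ.injective
      rw [map_zero, ← Matrix.mul_one (ψ _), ← hb, ← Matrix.mul_assoc, hzero, Matrix.zero_mul]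
    have h3 : u = 0 := extMap_injective (f := φ.toAlgHom) φ.injective (by rw [map_zero]; exact h1)
    rw [h3, map_zero] at hu
    have h4 : (Matrix.single 0 0 1 * b') * b = 0 := by rw [← hu, Matrix.zero_mul]
    rw [Matrix.mul_assoc, hb', Matrix.mul_one] at h4
    have := congr_fun₂ h4 0 0
    simp at this
  refine ⟨τ, f⁻¹ • g, b, b', hb, hb', hτρ, ?_⟩
  rw [← hρ, map_smul, hρg, ← hf, algebraMap_smul, smul_smul, inv_mul_cancel₀, one_smul]
  rintro rfl
  exact hd0 (by rw [← hf, map_zero])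

open Matrix in
/-- The kernels of `ℓ₁` and `ℓ₂` are forms of the spaces of skew-symmetric matrices: over every
algebraically closed field there is a splitting of `A` and an invertible matrix `b` such that
`x` is in the kernel of `ℓ₁` iff `x b` is skew-symmetric, and in the kernel of `ℓ₂` iff `b⁻¹ x` is.
A product of an element of the first kernel and one of the second thus becomes a product of two
skew-symmetric matrices. -/
def IsSkewPair {F A : Type u} [Field F] [Ring A] [Algebra F A] (n : ℕ) (ℓ₁ ℓ₂ : A →ₗ[F] A) :
    Prop :=
  ∀ (Ω : Type u) [Field Ω] [Algebra F Ω] [IsAlgClosed Ω],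
    ∃ (ψ : Ω ⊗[F] A ≃ₐ[Ω] Matrix (Fin n) (Fin n) Ω) (b b' : Matrix (Fin n) (Fin n) Ω),
      b * b' = 1 ∧ b' * b = 1 ∧
      (∀ x, ℓ₁.lTensor Ω x = 0 ↔ (ψ x * b)ᵀ = -(ψ x * b)) ∧
      (∀ x, ℓ₂.lTensor Ω x = 0 ↔ (b' * ψ x)ᵀ = -(b' * ψ x))

open Matrix in
/-- The maps `x ↦ τ x + g x` and `x ↦ τ x g + x`, for `τ` and `g` as in
`exists_antihom_splitting`. -/
theorem exists_isSkewPair {F A : Type u} [Field F] (h2 : (2 : F) ≠ 0) [Ring A]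
    [Algebra F A] [FiniteDimensional F A] [Algebra.IsCentral F A] [IsSimpleRing A]
    (hs : IsSplitAlgebra F (A ⊗[F] A)) :
    ∃ ℓ₁ ℓ₂ : A →ₗ[F] A, IsSkewPair (csaDegree F A) ℓ₁ ℓ₂ := by
  obtain ⟨n, hn, hdeg, hdim, ⟨ψ₀⟩⟩ := exists_algEquiv_matrix_of_isAlgClosed (AlgebraicClosure F) hs
  rw [hdeg]
  obtain ⟨τ, g, b, b', hb, hb', hτ, hg⟩ := exists_antihom_splitting h2 hs hn hdim _ ψ₀
  refine ⟨τ + LinearMap.mulLeft F g, (LinearMap.mulRight F g).comp τ + LinearMap.id, ?_⟩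
  intro Ω _ _ _
  let j : AlgebraicClosure F →ₐ[F] Ω := IsAlgClosed.lift
  let ρ : A →ₐ[F] Matrix (Fin n) (Fin n) Ω := j.mapMatrix.comp
    ((ψ₀.toAlgHom.restrictScalars F).comp Algebra.TensorProduct.includeRight)
  have hρ : ∀ a, ρ a = (ψ₀ (1 ⊗ₜ a)).map j := fun _ => rfl
  obtain ⟨ψ, hψ⟩ := exists_algEquiv_of_algHom hs hn hdim ρ
  have hτΩ : ∀ x, ψ (τ.lTensor Ω x) = b.map j * (ψ x)ᵀ * b'.map j := fun x => by
    induction x with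
    | zero => simp
    | add y z hy hz => simp only [map_add, hy, hz, transpose_add, Matrix.mul_add, Matrix.add_mul]
    | tmul r a =>
      rw [LinearMap.lTensor_tmul, hψ, hψ, hρ, hτ, hρ, Matrix.map_mul, Matrix.map_mul,
        transpose_smul, transpose_map, Matrix.mul_smul, Matrix.smul_mul]
  have hgΩ : ψ (1 ⊗ₜ g) = b.map j * (b'.map j)ᵀ := by
    rw [hψ, hρ, hg, Matrix.map_mul, one_smul, transpose_map]
  have hc : b.map j * b'.map j = 1 := by
    rw [← Matrix.map_mul, hb, Matrix.map_one _ (map_zero j) (map_one j)]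
  have hc' : b'.map j * b.map j = 1 := by
    rw [← Matrix.map_mul, hb', Matrix.map_one _ (map_zero j) (map_one j)]
  refine ⟨ψ, b.map j, b'.map j, hc, hc', ?_⟩
  generalize b.map j = c at *
  generalize b'.map j = c' at *
  have hc1 : ∀ x : Matrix (Fin n) (Fin n) Ω, c * (c' * x) = x := fun x => by
    rw [← Matrix.mul_assoc, hc, Matrix.one_mul]
  have hc2 : ∀ x : Matrix (Fin n) (Fin n) Ω, c' * (c * x) = x := fun x => by
    rw [← Matrix.mul_assoc, hc', Matrix.one_mul]
  have ht : c'ᵀ * cᵀ = 1 := by rw [← transpose_mul, hc, transpose_one]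
  have ht' : cᵀ * c'ᵀ = 1 := by rw [← transpose_mul, hc', transpose_one]
  have hc3 : ∀ x : Matrix (Fin n) (Fin n) Ω, c'ᵀ * (cᵀ * x) = x := fun x => by
    rw [← Matrix.mul_assoc, ht, Matrix.one_mul]
  have hc4 : ∀ x : Matrix (Fin n) (Fin n) Ω, cᵀ * (c'ᵀ * x) = x := fun x => by
    rw [← Matrix.mul_assoc, ht', Matrix.one_mul]
  have hmulLeft : ∀ x, (LinearMap.mulLeft F g).lTensor Ω x = 1 ⊗ₜ g * x := fun x => by
    induction x with
    | zero => simp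
    | add y z hy hz => simp only [map_add, hy, hz, mul_add]
    | tmul r a => simp
  have hmulRight : ∀ x, (LinearMap.mulRight F g).lTensor Ω x = x * 1 ⊗ₜ g := fun x => by
    induction x with
    | zero => simp
    | add y z hy hz => simp only [map_add, hy, hz, add_mul]
    | tmul r a => simp
  refine ⟨fun x => ?_, fun x => ?_⟩
  · rw [LinearMap.lTensor_add, LinearMap.add_apply, hmulLeft, ← map_eq_zero_iff ψ ψ.injective,
      map_add, map_mul, hτΩ, hgΩ, transpose_mul]
    refine ⟨fun h => ?_, fun h => ?_⟩
    · have h1 := congrArg (fun x => cᵀ * (c' * (x * c))) h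
      simp only [Matrix.add_mul, Matrix.mul_add, Matrix.mul_assoc, hc2, hc4, hc',
        Matrix.mul_one, Matrix.zero_mul, Matrix.mul_zero] at h1
      exact eq_neg_of_add_eq_zero_left h1
    · have h1 := congrArg (fun x => c * (c'ᵀ * (x * c'))) h
      simp only [Matrix.mul_neg, Matrix.neg_mul, Matrix.mul_assoc, hc3, hc, Matrix.mul_one] at h1
      rw [Matrix.mul_assoc, h1, Matrix.mul_assoc, neg_add_cancel]
  · rw [LinearMap.lTensor_add, LinearMap.add_apply, LinearMap.lTensor_id, LinearMap.lTensor_comp,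
      LinearMap.comp_apply, hmulRight, ← map_eq_zero_iff ψ ψ.injective,
      map_add, map_mul, hτΩ, hgΩ, transpose_mul, LinearMap.id_apply]
    simp only [Matrix.mul_assoc, hc2]
    refine ⟨fun h => ?_, fun h => ?_⟩
    · have h1 := congrArg (fun x => c' * x) h
      simp only [Matrix.mul_add, Matrix.mul_zero, hc2] at h1
      exact eq_neg_of_add_eq_zero_left h1
    · rw [h, Matrix.mul_neg, hc1, neg_add_cancel]

/-! ### Products of two skew-symmetric matrices -/

/-- An endomorphism has a vector whose annihilator is generated by the minimal polynomial: a vector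
outside the kernels of the endomorphisms `(μ / (X - r))(T)`, for the roots `r` of the minimal
polynomial `μ`. -/
theorem Module.End.exists_minpoly_dvd_of_aeval_apply_eq_zero {K V : Type*} [Field K]
    [IsAlgClosed K] [AddCommGroup V] [Module K V] [FiniteDimensional K V] (T : Module.End K V) :
    ∃ x : V, ∀ f : Polynomial K, Polynomial.aeval T f x = 0 → minpoly K T ∣ f := by
  classical
  have : Infinite K := IsAlgClosed.instInfinite
  have hint : IsIntegral K T := Algebra.IsIntegral.isIntegral T
  have hμ0 : minpoly K T ≠ 0 := minpoly.ne_zero hint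
  let q : K → Polynomial K := fun r => minpoly K T / (Polynomial.X - Polynomial.C r)
  have hq : ∀ r, (minpoly K T).IsRoot r → (Polynomial.X - Polynomial.C r) * q r = minpoly K T :=
    fun r hr => Polynomial.mul_div_eq_iff_isRoot.2 hr
  obtain ⟨x, hx⟩ : ∃ x : V, ∀ r ∈ (minpoly K T).roots.toFinset,
      x ∉ LinearMap.ker (Polynomial.aeval T (q r)) := by
    have := Subspace.biUnion_ne_univ_of_top_notMem
      (s := (minpoly K T).roots.toFinset.image fun r => LinearMap.ker (Polynomial.aeval T (q r)))
      (by
        intro h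
        rw [Finset.mem_image] at h
        obtain ⟨r, hr, htop⟩ := h
        rw [Multiset.mem_toFinset, Polynomial.mem_roots hμ0] at hr
        have h0 : Polynomial.aeval T (q r) = 0 := LinearMap.ker_eq_top.1 htop
        have hdvd := minpoly.dvd K T h0
        have hq0 : q r ≠ 0 := fun h => hμ0 (by rw [← hq r hr, h, mul_zero])
        have h1 := Polynomial.natDegree_le_of_dvd hdvd hq0
        rw [← hq r hr, Polynomial.natDegree_mul (Polynomial.X_sub_C_ne_zero r) hq0,
          Polynomial.natDegree_X_sub_C] at h1
        omega)
    rw [Set.ne_univ_iff_exists_notMem] at this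
    obtain ⟨x, hx⟩ := this
    refine ⟨x, fun r hr hxr => hx ?_⟩
    simp only [Finset.mem_image, Set.mem_iUnion]
    exact ⟨_, ⟨r, hr, rfl⟩, hxr⟩
  refine ⟨x, fun f hf => ?_⟩
  let d := EuclideanDomain.gcd f (minpoly K T)
  have hd : Polynomial.aeval T d x = 0 := by
    rw [show d = f * EuclideanDomain.gcdA f (minpoly K T) +
      minpoly K T * EuclideanDomain.gcdB f (minpoly K T) from EuclideanDomain.gcd_eq_gcd_ab _ _,
      mul_comm f, map_add, map_mul, map_mul, minpoly.aeval, zero_mul, add_zero,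
      Module.End.mul_apply, hf, map_zero]
  obtain ⟨k, hk⟩ : d ∣ minpoly K T := EuclideanDomain.gcd_dvd_right _ _
  have hk0 : k ≠ 0 := by rintro rfl; exact hμ0 (by rw [hk, mul_zero])
  by_cases hdeg : k.degree = 0
  · have hu : IsUnit k := Polynomial.isUnit_iff_degree_eq_zero.2 hdeg
    have : minpoly K T ∣ d := by
      rw [hk]; exact (hu.mul_right_dvd).2 dvd_rfl
    exact this.trans (EuclideanDomain.gcd_dvd_left _ _)
  · exfalso
    obtain ⟨r, hr⟩ := IsAlgClosed.exists_root k hdeg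
    have hroot : (minpoly K T).IsRoot r := by
      rw [hk, Polynomial.IsRoot, Polynomial.eval_mul, hr, mul_zero]
    obtain ⟨l, hl⟩ := Polynomial.dvd_iff_isRoot.2 hr
    apply hx r (by rw [Multiset.mem_toFinset, Polynomial.mem_roots hμ0]; exact hroot)
    have : q r = l * d := by
      apply mul_left_cancel₀ (Polynomial.X_sub_C_ne_zero r)
      rw [hq r hroot, hk, hl]; ring
    rw [LinearMap.mem_ker, this, map_mul, Module.End.mul_apply, hd, map_zero]

section SkewProduct

open Matrix

variable {K : Type*} [Field K] {n : ℕ} {v v' w : Matrix (Fin n) (Fin n) K}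

/-- For `v` and `w` skew-symmetric, every polynomial in `v w` becomes skew-symmetric after
multiplication by `v`. -/
theorem Matrix.transpose_aeval_mul_skew (hv : vᵀ = -v) (hw : wᵀ = -w) (f : Polynomial K) :
    (Polynomial.aeval (v * w) f * v)ᵀ = -(Polynomial.aeval (v * w) f * v) := by
  induction f using Polynomial.induction_on' with
  | add p q hp hq => rw [map_add, Matrix.add_mul, transpose_add, hp, hq, neg_add]
  | monomial k a =>
    have h : ∀ k : ℕ, v * ((v * w) ^ k)ᵀ = (v * w) ^ k * v := fun k => by
      induction k with
      | zero => simp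
      | succ k ih =>
        rw [pow_succ', transpose_mul, ← Matrix.mul_assoc, ih, transpose_mul, hv, hw, neg_mul_neg,
          Matrix.mul_assoc, ← Matrix.mul_assoc v w v, ← Matrix.mul_assoc, ← pow_succ, pow_succ']
    rw [Polynomial.aeval_monomial, ← Algebra.smul_def, Matrix.smul_mul, transpose_smul,
      transpose_mul, hv, Matrix.neg_mul, h, smul_neg]

theorem Matrix.aeval_mul_skew (hv : vᵀ = -v) (hw : wᵀ = -w) (f : Polynomial K) :
    Polynomial.aeval (v * w) f * v = v * (Polynomial.aeval (v * w) f)ᵀ := by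
  have := Matrix.transpose_aeval_mul_skew hv hw f
  rw [transpose_mul, hv, Matrix.neg_mul, neg_inj] at this
  exact this.symm

theorem Matrix.dotProduct_mulVec_self_of_skew (h2 : (2 : K) ≠ 0) {s : Matrix (Fin n) (Fin n) K}
    (hs : sᵀ = -s) (x : Fin n → K) : x ⬝ᵥ (s *ᵥ x) = 0 := by
  have h : x ⬝ᵥ (s *ᵥ x) = - (x ⬝ᵥ (s *ᵥ x)) := by
    conv_lhs => rw [dotProduct_comm, ← vecMul_transpose, ← dotProduct_mulVec, hs, neg_mulVec,
      dotProduct_neg]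
  have h3 : 2 * (x ⬝ᵥ (s *ᵥ x)) = 0 := by linear_combination h
  exact (mul_eq_zero.1 h3).resolve_left h2

/-- The minimal polynomial of a product `v w` of skew-symmetric matrices of size `2m` has degree at
most `m`: the subspaces generated by one vector under `v w` are totally isotropic for the
alternating form with matrix `v⁻¹`. -/
theorem Matrix.natDegree_minpoly_mul_skew_le [IsAlgClosed K] (h2 : (2 : K) ≠ 0) {m : ℕ}
    (hn : n = 2 * m) (hv : vᵀ = -v) (hw : wᵀ = -w) (hvv' : v * v' = 1) (hv'v : v' * v = 1) :
    (minpoly K (v * w)).natDegree ≤ m := by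
  let y := v * w
  let T : Module.End K (Fin n → K) := Matrix.toLinAlgEquiv' y
  have hT : minpoly K T = minpoly K y := minpoly.algEquiv_eq _ _
  have hTf : ∀ (f : Polynomial K) (x : Fin n → K),
      Polynomial.aeval T f x = Polynomial.aeval y f *ᵥ x := fun f x => by
    rw [show Polynomial.aeval T f = Matrix.toLinAlgEquiv' (Polynomial.aeval y f) from
      Polynomial.aeval_algHom_apply (Matrix.toLinAlgEquiv' : _ ≃ₐ[K] Module.End K (Fin n → K)) y f]
    rfl
  obtain ⟨x, hx⟩ := Module.End.exists_minpoly_dvd_of_aeval_apply_eq_zero T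
  let S : Submodule K (Fin n → K) :=
    LinearMap.range ((LinearMap.applyₗ x).comp (Polynomial.aeval T).toLinearMap)
  have hv' : v'ᵀ = -v' := by
    have h1 : v'ᵀ * v = -1 := by
      rw [← neg_inj, neg_neg, ← Matrix.mul_neg, ← hv, ← transpose_mul, hvv', transpose_one]
    rw [← Matrix.mul_one v'ᵀ, ← hvv', ← Matrix.mul_assoc, h1, Matrix.neg_mul, Matrix.one_mul]
  have hadj : ∀ f : Polynomial K,
      (Polynomial.aeval y f)ᵀ * v' = v' * Polynomial.aeval y f := fun f => by
    have h1 : Polynomial.aeval y f * v = v * (Polynomial.aeval y f)ᵀ :=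
      Matrix.aeval_mul_skew hv hw f
    have h3 := congrArg (fun z => v' * (z * v')) h1
    simp only [Matrix.mul_assoc, hvv', Matrix.mul_one] at h3
    rw [h3, ← Matrix.mul_assoc, hv'v, Matrix.one_mul]
  have hiso : ∀ s ∈ S, ∀ t ∈ S, s ⬝ᵥ (v' *ᵥ t) = 0 := by
    rintro _ ⟨f, rfl⟩ _ ⟨g, rfl⟩
    change Polynomial.aeval T f x ⬝ᵥ (v' *ᵥ Polynomial.aeval T g x) = 0
    have h1 : ∀ (a : Matrix (Fin n) (Fin n) K) z, (a *ᵥ x) ⬝ᵥ z = x ⬝ᵥ (aᵀ *ᵥ z) := fun a z => by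
      rw [dotProduct_mulVec, vecMul_transpose]
    rw [hTf, hTf, h1, mulVec_mulVec, mulVec_mulVec, hadj, Matrix.mul_assoc,
      ← map_mul]
    refine Matrix.dotProduct_mulVec_self_of_skew h2 ?_ x
    rw [← hadj, transpose_mul, transpose_transpose, hv', Matrix.neg_mul, hadj]
  have hS : 2 * Module.finrank K S ≤ n := by
    let φ : (Fin n → K) →ₗ[K] Module.Dual K (Fin n → K) :=
      (dotProductBilin K K).flip.comp (Matrix.toLin' v')
    have hφ : ∀ s t, φ s t = t ⬝ᵥ (v' *ᵥ s) := fun _ _ => rfl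
    have hinj : Function.Injective φ := by
      rw [← LinearMap.ker_eq_bot, LinearMap.ker_eq_bot']
      intro s hs
      have h1 : v' *ᵥ s = 0 := by
        apply dotProduct_eq_zero _
        intro t
        rw [dotProduct_comm, ← hφ, hs]; rfl
      rw [← one_mulVec s, ← hvv', ← mulVec_mulVec, h1, mulVec_zero]
    have hle : S.map φ ≤ S.dualAnnihilator := by
      rintro _ ⟨s, hs, rfl⟩
      rw [Submodule.mem_dualAnnihilator]
      exact fun t ht => hiso t ht s hs
    have h1 := Submodule.finrank_mono hle
    rw [← (Submodule.equivMapOfInjective φ hinj S).finrank_eq] at h1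
    have h3 := Subspace.finrank_add_finrank_dualAnnihilator_eq S
    rw [Module.finrank_fin_fun] at h3
    omega
  have hdeg : (minpoly K y).natDegree ≤ Module.finrank K S := by
    let θ : Polynomial.degreeLT K (minpoly K y).natDegree →ₗ[K] S :=
      (LinearMap.rangeRestrict _).comp (Submodule.subtype _)
    have hθ : Function.Injective θ := by
      rw [← LinearMap.ker_eq_bot, LinearMap.ker_eq_bot']
      intro f hf
      have h1 : Polynomial.aeval T f.1 x = 0 := congrArg Subtype.val hf
      have h3 := hx f.1 h1
      rw [hT] at h3
      have h4 := Polynomial.mem_degreeLT.1 f.2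
      by_contra hne
      have hne' : f.1 ≠ 0 := fun h => hne (Subtype.ext h)
      rw [Polynomial.degree_eq_natDegree hne', Nat.cast_lt] at h4
      exact absurd (Polynomial.natDegree_le_of_dvd h3 hne') (by omega)
    have := LinearMap.finrank_le_finrank_of_injective hθ
    rwa [(Polynomial.degreeLTEquiv K _).finrank_eq, Module.finrank_fin_fun] at this
  change (minpoly K y).natDegree ≤ m
  omega

end SkewProduct

/-! ### Ranks of idempotent matrices -/

section Rank

open Matrix

variable {K : Type*} [Field K] {n : ℕ}

/-- The right ideal of a matrix algebra generated by `M` is the space of maps to its range. -/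
theorem Matrix.finrank_range_mulLeft (M : Matrix (Fin n) (Fin n) K) :
    Module.finrank K (LinearMap.range (LinearMap.mulLeft K M)) = n * M.rank := by
  let T : (Fin n → K) →ₗ[K] Fin n → K := M.mulVecLin
  let t : Matrix (Fin n) (Fin n) K ≃ₗ[K] ((Fin n → K) →ₗ[K] Fin n → K) := Matrix.toLin'
  let φ : ((Fin n → K) →ₗ[K] LinearMap.range T) →ₗ[K] Matrix (Fin n) (Fin n) K :=
    t.symm.toLinearMap.comp (LinearMap.compRight K (LinearMap.range T).subtype)
  have hφ : Function.Injective φ := t.symm.injective.comp fun f g hfg => by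
    exact LinearMap.ext fun x => Subtype.ext (LinearMap.congr_fun hfg x)
  have hrange : LinearMap.range φ = LinearMap.range (LinearMap.mulLeft K M) := by
    apply le_antisymm
    · rintro _ ⟨f, rfl⟩
      obtain ⟨h, hh⟩ := Module.projective_lifting_property T.rangeRestrict f
        T.surjective_rangeRestrict
      refine ⟨t.symm h, t.injective ?_⟩
      rw [← hh]
      change t (M * t.symm h) = t (t.symm _)
      rw [t.apply_symm_apply]
      change Matrix.toLin' (M * Matrix.toLin'.symm h) = _
      rw [Matrix.toLin'_mul, LinearEquiv.apply_symm_apply]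
      rfl
    · rintro _ ⟨x, rfl⟩
      refine ⟨T.rangeRestrict.comp (t x), t.injective ?_⟩
      change t (t.symm _) = Matrix.toLin' (M * x)
      rw [t.apply_symm_apply, Matrix.toLin'_mul]
      rfl
  rw [← hrange, LinearMap.finrank_range_of_inj hφ, Module.finrank_linearMap, Module.finrank_fin_fun]
  rfl

theorem reducedRank_eq_rank {A : Type*} [Ring A] [Algebra K A] (hn : n ≠ 0)
    (ψ : A ≃ₐ[K] Matrix (Fin n) (Fin n) K) (e : A) : reducedRank K A e = (ψ e).rank := by
  have h1 : csaDegree K A = n := by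
    rw [csaDegree, ψ.toLinearEquiv.finrank_eq, Module.finrank_matrix]
    simp
  have h2 : (LinearMap.range (LinearMap.mulLeft K e)).map ψ.toLinearMap =
      LinearMap.range (LinearMap.mulLeft K (ψ e)) := by
    ext x
    constructor
    · rintro ⟨_, ⟨y, rfl⟩, rfl⟩
      exact ⟨ψ y, (map_mul ψ e y).symm⟩
    · rintro ⟨y, rfl⟩
      exact ⟨_, ⟨ψ.symm y, rfl⟩, by simp⟩
  have h3 := (Submodule.equivMapOfInjective ψ.toLinearMap ψ.injective
    (LinearMap.range (LinearMap.mulLeft K e))).finrank_eq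
  rw [reducedRank, h1, h3, h2, Matrix.finrank_range_mulLeft,
    Nat.mul_div_cancel_left _ (Nat.pos_of_ne_zero hn)]

/-- The ranks of complete orthogonal idempotent matrices add up to the size. -/
theorem CompleteOrthogonalIdempotents.sum_rank {m : ℕ} (hn : n ≠ 0)
    {e : Fin m → Matrix (Fin n) (Fin n) K} (he : CompleteOrthogonalIdempotents e) :
    ∑ i, (e i).rank = n := by
  let φ : Matrix (Fin n) (Fin n) K ≃ₗ[K] (Π i, LinearMap.range (LinearMap.mulLeft K (e i))) :=
    { toFun := fun x i => ⟨e i * x, x, rfl⟩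
      map_add' := fun x y => by ext1 i; exact Subtype.ext (mul_add _ _ _)
      map_smul' := fun r x => by ext1 i; exact Subtype.ext (Matrix.mul_smul _ _ _)
      invFun := fun x => ∑ i, (x i : Matrix (Fin n) (Fin n) K)
      left_inv := fun x => by
        change ∑ i, e i * x = x
        rw [← Finset.sum_mul, he.complete, one_mul]
      right_inv := fun x => by
        ext1 i
        apply Subtype.ext
        change e i * ∑ j, (x j : Matrix (Fin n) (Fin n) K) = x i
        rw [Finset.mul_sum, Finset.sum_eq_single i]
        · obtain ⟨y, hy⟩ := (x i).2
          rw [← hy, LinearMap.mulLeft_apply, ← mul_assoc, he.idem i]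
        · intro j _ hj
          obtain ⟨y, hy⟩ := (x j).2
          rw [← hy, LinearMap.mulLeft_apply, ← mul_assoc, he.ortho hj.symm, zero_mul]
        · simp }
  have h := φ.finrank_eq
  rw [Module.finrank_pi_fintype, Module.finrank_matrix] at h
  simp only [Matrix.finrank_range_mulLeft, ← Finset.mul_sum, Fintype.card_fin,
    Module.finrank_self, mul_one] at h
  exact (Nat.eq_of_mul_eq_mul_left (Nat.pos_of_ne_zero hn) h).symm

/-- A nonzero matrix that becomes skew-symmetric after multiplication by an invertible one has rank
at least two. -/
theorem Matrix.two_le_rank_of_skew (h2 : (2 : K) ≠ 0) {e v v' : Matrix (Fin n) (Fin n) K}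
    (he : e ≠ 0) (hvv' : v * v' = 1) (hs : (e * v)ᵀ = -(e * v)) : 2 ≤ e.rank := by
  by_contra! hlt
  have hs0 : e * v ≠ 0 := fun h => he (by
    rw [← Matrix.mul_one e, ← hvv', ← Matrix.mul_assoc, h, Matrix.zero_mul])
  refine hs0 (Matrix.eq_zero_of_skew_of_mul_mul h2 hs fun y => ?_)
  have hle : Module.finrank K (LinearMap.range e.mulVecLin) ≤ 1 := Nat.le_of_lt_succ hlt
  obtain ⟨⟨a, ha⟩, hspan⟩ := finrank_le_one_iff.1 hle
  choose c hc using fun x : Fin n → K => hspan ⟨e *ᵥ x, x, rfl⟩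
  have hc' : ∀ x, e *ᵥ x = c x • a := fun x => (congrArg Subtype.val (hc x)).symm
  refine ⟨c ((v * y) *ᵥ a), ?_⟩
  apply Matrix.toLin'.injective
  refine LinearMap.ext fun x => ?_
  rw [Matrix.toLin'_apply, Matrix.toLin'_apply, smul_mulVec, Matrix.mul_assoc e v y,
    ← mulVec_mulVec, ← mulVec_mulVec x e v, hc' (v *ᵥ x), mulVec_smul,
    ← mulVec_mulVec a e, hc' ((v * y) *ᵥ a), smul_comm]

/-- For complete orthogonal idempotents of rank two with bases `(aᵢ, cᵢ)` of their ranges, the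
matrix `∑ (aᵢ cᵢᵀ - cᵢ aᵢᵀ)` is invertible and skew-symmetric, and the idempotents are
self-adjoint for it. -/
theorem CompleteOrthogonalIdempotents.exists_skew {m : ℕ}
    {e : Fin m → Matrix (Fin n) (Fin n) K} (he : CompleteOrthogonalIdempotents e)
    (hr : ∀ i, (e i).rank = 2) :
    ∃ v : Matrix (Fin n) (Fin n) K, IsUnit v ∧ vᵀ = -v ∧ ∀ i, e i * v = v * (e i)ᵀ := by
  have hbasis : ∀ i, ∃ a c : Fin n → K, e i *ᵥ a = a ∧ e i *ᵥ c = c ∧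
      LinearIndependent K ![a, c] ∧ ∀ x, ∃ r t : K, e i *ᵥ x = r • a + t • c := fun i => by
    let B := Module.finBasisOfFinrankEq K (LinearMap.range (e i).mulVecLin) (hr i)
    have hB : ∀ k, e i *ᵥ (B k : Fin n → K) = B k := fun k => by
      obtain ⟨y, hy⟩ := (B k).2
      rw [← hy, mulVecLin_apply, mulVec_mulVec, he.idem i]
    refine ⟨B 0, B 1, hB 0, hB 1, ?_, fun x => ?_⟩
    · have := B.linearIndependent.map' (Submodule.subtype _) (Submodule.ker_subtype _)
      rwa [show (Submodule.subtype _ ∘ B : Fin 2 → Fin n → K) =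
        ![(B 0 : Fin n → K), (B 1 : Fin n → K)] from
          funext fun k => by fin_cases k <;> rfl] at this
    · refine ⟨B.repr ⟨e i *ᵥ x, x, rfl⟩ 0, B.repr ⟨e i *ᵥ x, x, rfl⟩ 1, ?_⟩
      have := congrArg Subtype.val (B.sum_repr ⟨e i *ᵥ x, x, rfl⟩)
      rw [Fin.sum_univ_two] at this
      exact this.symm
  choose a c ha hc hli hspan using hbasis
  have hortho : ∀ {i j}, i ≠ j → ∀ x, e i *ᵥ x = x → e j *ᵥ x = 0 := fun hij x hx => by
    rw [← hx, mulVec_mulVec, he.ortho hij.symm, zero_mulVec]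
  let v := ∑ i, (vecMulVec (a i) (c i) - vecMulVec (c i) (a i))
  have hvt : vᵀ = -v := by
    simp only [v, transpose_sum, transpose_sub, transpose_vecMulVec, ← Finset.sum_neg_distrib,
      neg_sub]
  have hev : ∀ i, e i * v = vecMulVec (a i) (c i) - vecMulVec (c i) (a i) := fun i => by
    simp only [v, Finset.mul_sum, Matrix.mul_sub, mul_vecMulVec]
    rw [Finset.sum_eq_single i]
    · rw [ha, hc]
    · intro j _ hj
      rw [hortho hj _ (ha j), hortho hj _ (hc j)]
      simp
    · simp
  refine ⟨v, ?_, hvt, fun i => ?_⟩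
  · rw [← Matrix.mulVec_injective_iff_isUnit]
    intro z z' hzz
    rw [← sub_eq_zero] at hzz ⊢
    change v *ᵥ z - v *ᵥ z' = 0 at hzz
    rw [← mulVec_sub] at hzz
    generalize z - z' = z at hzz
    have h0 : ∀ i, c i ⬝ᵥ z = 0 ∧ a i ⬝ᵥ z = 0 := fun i => by
      have h1 : (e i * v) *ᵥ z = 0 := by rw [← mulVec_mulVec, hzz, mulVec_zero]
      rw [hev, sub_mulVec, vecMulVec_mulVec, vecMulVec_mulVec] at h1
      have h3 := LinearIndependent.pair_iff.1 (hli i) (c i ⬝ᵥ z) (-(a i ⬝ᵥ z)) (by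
        rw [neg_smul, ← sub_eq_add_neg, ← h1]
        ext k; simp [mul_comm])
      exact ⟨h3.1, neg_eq_zero.1 h3.2⟩
    refine dotProduct_eq_zero _ fun x => ?_
    have hx : x = ∑ i, e i *ᵥ x := by
      rw [← Matrix.sum_mulVec, he.complete, one_mulVec]
    rw [hx, dotProduct_sum]
    refine Finset.sum_eq_zero fun i _ => ?_
    obtain ⟨r, t, hrt⟩ := hspan i x
    rw [hrt, dotProduct_add, dotProduct_smul, dotProduct_smul, dotProduct_comm z,
      dotProduct_comm z, (h0 i).1, (h0 i).2]
    simp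
  · have h1 : v * (e i)ᵀ = -(e i * v)ᵀ := by rw [transpose_mul, hvt, Matrix.neg_mul, neg_neg]
    rw [h1, hev, transpose_sub, transpose_vecMulVec, transpose_vecMulVec, neg_sub]

end Rank

/-! ### The type of a product of skew-symmetric matrices -/

section TypeOfSkewProduct

variable {K : Type*} [Field K]

theorem Polynomial.Separable.exists_injective_roots [IsAlgClosed K] {P : Polynomial K}
    (hP : P.Monic) (hsep : P.Separable) :
    ∃ r : Fin P.natDegree → K, Function.Injective r ∧ ∀ i, P.eval (r i) = 0 := by
  classical
  have hcard : P.roots.toFinset.card = P.natDegree := by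
    rw [Multiset.toFinset_card_of_nodup (Polynomial.nodup_roots hsep)]
    exact (IsAlgClosed.splits P).natDegree_eq_card_roots.symm
  let e := (P.roots.toFinset.equivFinOfCardEq hcard).symm
  refine ⟨fun i => e i, fun i j hij => e.injective (Subtype.ext hij), fun i => ?_⟩
  exact (Polynomial.mem_roots hP.ne_zero).1 (Multiset.mem_toFinset.1 (e i).2)

open Polynomial in
/-- The subalgebra generated by a zero of a monic polynomial with `m` distinct roots is spanned by
the Lagrange idempotents. -/
theorem exists_lagrange_idempotents {B : Type*} [Ring B] [Algebra K B] {m : ℕ} (hm : m ≠ 0) (y : B)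
    {P : K[X]} (hP : P.Monic) (hdeg : P.natDegree = m) {r : Fin m → K}
    (hr : Function.Injective r) (hroot : ∀ i, P.eval (r i) = 0) (hy : aeval y P = 0) :
    CompleteOrthogonalIdempotents (fun i => aeval y (Lagrange.basis Finset.univ r i)) ∧
      (∀ f : K[X], aeval y f =
        ∑ i, f.eval (r i) • aeval y (Lagrange.basis Finset.univ r i)) := by
  have hinj : Set.InjOn r (Finset.univ : Finset (Fin m)) := hr.injOn
  have hdvd : ∀ f : K[X], (∀ i, f.eval (r i) = 0) → aeval y f = 0 := fun f hf => by
    have h1 : f %ₘ P = 0 := by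
      refine Polynomial.eq_zero_of_degree_lt_of_eval_index_eq_zero _ hinj ?_ fun i _ => ?_
      · have := degree_modByMonic_lt f hP
        rwa [degree_eq_natDegree hP.ne_zero, hdeg, ← Fintype.card_fin m] at this
      · have := congrArg (eval (r i)) (modByMonic_add_div f P)
        rwa [eval_add, eval_mul, hroot, zero_mul, add_zero, hf] at this
    rw [← modByMonic_add_div f P, h1, zero_add, map_mul, hy, zero_mul]
  have hbasis : ∀ i j, (Lagrange.basis Finset.univ r i).eval (r j) = if i = j then 1 else 0 := by
    intro i j
    split_ifs with h
    · subst h; exact Lagrange.eval_basis_self hinj (Finset.mem_univ i)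
    · exact Lagrange.eval_basis_of_ne h (Finset.mem_univ j)
  refine ⟨CompleteOrthogonalIdempotents.iff_ortho_complete.2 ⟨fun i j hij => ?_, ?_⟩, fun f => ?_⟩
  · change aeval y _ * aeval y _ = 0
    rw [← map_mul]
    refine hdvd _ fun k => ?_
    rw [eval_mul, hbasis, hbasis]
    by_cases h : i = k
    · subst h; simp [hij.symm]
    · simp [h]
  · have : Nonempty (Fin m) := ⟨⟨0, Nat.pos_of_ne_zero hm⟩⟩
    rw [← map_sum, Lagrange.sum_basis hinj Finset.univ_nonempty, map_one]
  · rw [← sub_eq_zero]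
    have := hdvd (f - ∑ i, f.eval (r i) • Lagrange.basis Finset.univ r i) fun k => by
      simp [eval_finsetSum, hbasis]
    simpa using this

open Matrix Polynomial in
/-- A product of an invertible and an arbitrary skew-symmetric matrix whose minimal polynomial is
separable of degree `m` generates a subalgebra of type `[2, …, 2]`: its minimal idempotents `e` have
rank at least two since `e v` is skew-symmetric, and the `m` ranks add up to `2m`. -/
theorem exists_idempotents_of_skew_product [IsAlgClosed K] (h2 : (2 : K) ≠ 0) {B : Type*} [Ring B]
    [Algebra K B] {n m : ℕ} (hm : m ≠ 0) (hn : n = 2 * m)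
    (ψ : B ≃ₐ[K] Matrix (Fin n) (Fin n) K) {y : B} {v v' w : Matrix (Fin n) (Fin n) K}
    (hv : vᵀ = -v) (hw : wᵀ = -w) (hvv' : v * v' = 1) (hy : ψ y = v * w) {P : K[X]}
    (hP : P.Monic) (hdeg : P.natDegree = m) (hsep : P.Separable) (hyP : aeval y P = 0)
    (hind : ∀ f : K[X], f.degree < m → aeval y f = 0 → f = 0) :
    ∃ e : Fin m → B, CompleteOrthogonalIdempotents e ∧ (∀ i, e i ≠ 0) ∧
      Submodule.span K (Set.range e) = Subalgebra.toSubmodule (Algebra.adjoin K {y}) ∧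
      ∀ i, reducedRank K B (e i) = 2 := by
  obtain ⟨r, hr, hroot⟩ := hsep.exists_injective_roots hP
  subst hdeg
  obtain ⟨he, hf⟩ := exists_lagrange_idempotents hm y hP rfl hr hroot hyP
  have hn0 : n ≠ 0 := by omega
  let e := fun i => aeval y (Lagrange.basis Finset.univ r i)
  have he0 : ∀ i, e i ≠ 0 := fun i h => by
    refine Lagrange.basis_ne_zero hr.injOn (Finset.mem_univ i) (hind _ ?_ h)
    rw [Lagrange.degree_basis hr.injOn (Finset.mem_univ i), Finset.card_univ, Fintype.card_fin,
      Nat.cast_lt]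
    omega
  have hψe : CompleteOrthogonalIdempotents (fun i => ψ (e i)) := he.map ψ.toRingHom
  have hsum : ∑ i, (ψ (e i)).rank = n := hψe.sum_rank hn0
  have hge : ∀ i, 2 ≤ (ψ (e i)).rank := fun i => by
    refine Matrix.two_le_rank_of_skew h2
      (fun h => he0 i ((map_eq_zero_iff ψ ψ.injective).1 h)) hvv' ?_
    have : ψ (e i) = aeval (v * w) (Lagrange.basis Finset.univ r i) := by
      rw [← hy]; exact (aeval_algHom_apply ψ y _).symm
    rw [this]
    exact Matrix.transpose_aeval_mul_skew hv hw _
  refine ⟨e, he, he0, ?_, fun i => ?_⟩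
  · rw [Algebra.adjoin_singleton_eq_range_aeval]
    apply le_antisymm
    · rw [Submodule.span_le]
      rintro _ ⟨i, rfl⟩
      exact ⟨_, rfl⟩
    · rintro _ ⟨f, rfl⟩
      change aeval y f ∈ _
      rw [hf]
      exact Submodule.sum_mem _ fun i _ => Submodule.smul_mem _ _ (Submodule.subset_span ⟨i, rfl⟩)
  · rw [reducedRank_eq_rank hn0 ψ]
    have h1 : ∑ i, ((ψ (e i)).rank) = ∑ _i : Fin P.natDegree, 2 := by
      rw [hsum, hn]; simp [mul_comm]
    exact ((Finset.sum_eq_sum_iff_of_le fun i _ => hge i).1 h1.symm i (Finset.mem_univ i)).symm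

end TypeOfSkewProduct

/-! ### Units and linear conditions under scalar extension -/

section ScalarExtension

variable {F : Type u} [Field F] {A : Type u} [Ring A] [Algebra F A]
variable {R S : Type u} [CommRing R] [Algebra F R] [CommRing S] [Algebra F S]

theorem extMap_lTensor (f : R →ₐ[F] S) (ℓ : A →ₗ[F] A) (x : R ⊗[F] A) :
    extMap A f (ℓ.lTensor R x) = ℓ.lTensor S (extMap A f x) := by
  induction x with
  | zero => simp
  | add y z hy hz => simp only [map_add, hy, hz]
  | tmul r a => rfl

theorem lTensor_smul (ℓ : A →ₗ[F] A) (r : R) (x : R ⊗[F] A) :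
    ℓ.lTensor R (r • x) = r • ℓ.lTensor R x := by
  induction x with
  | zero => simp
  | add y z hy hz => simp only [map_add, smul_add, hy, hz]
  | tmul r a => rfl

theorem extSubalgebra_toSubmodule (f : R →ₐ[F] S) (E : Subalgebra R (R ⊗[F] A)) :
    Subalgebra.toSubmodule (extSubalgebra f E) =
      Submodule.span S (extMap A f '' (E : Set (R ⊗[F] A))) := by
  rw [extSubalgebra, Algebra.adjoin_eq_span]
  congr 1
  have : (extMap A f '' (E : Set (R ⊗[F] A))) =
      (E.toSubsemiring.toSubmonoid.map (extMap A f : R ⊗[F] A →* S ⊗[F] A) : Set _) := rfl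
  rw [this, Submonoid.closure_eq]

theorem extSubalgebra_adjoin_singleton (f : R →ₐ[F] S) (y : R ⊗[F] A) :
    extSubalgebra f (Algebra.adjoin R {y}) = Algebra.adjoin S {extMap A f y} := by
  apply le_antisymm
  · refine Algebra.adjoin_le ?_
    rintro _ ⟨x, hx, rfl⟩
    refine Algebra.adjoin_induction
      (p := fun x _ => extMap A f x ∈ Algebra.adjoin S {extMap A f y}) ?_ ?_ ?_ ?_ hx
    · rintro x rfl
      exact Algebra.subset_adjoin rfl
    · intro s
      rw [Algebra.algebraMap_eq_smul_one, extMap_smul, map_one]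
      exact Subalgebra.smul_mem _ (one_mem _) _
    · intro x y _ _ hx hy
      rw [map_add]; exact add_mem hx hy
    · intro x y _ _ hx hy
      rw [map_mul]; exact mul_mem hx hy
  · refine Algebra.adjoin_le ?_
    rintro _ rfl
    exact extMap_mem f (Algebra.subset_adjoin rfl)

theorem extMap_aeval (f : R →ₐ[F] S) (y : R ⊗[F] A) (p : Polynomial R) :
    extMap A f (Polynomial.aeval y p) = Polynomial.aeval (extMap A f y) (p.map (f : R →+* S)) := by
  induction p using Polynomial.induction_on' with
  | add p q hp hq => simp only [map_add, Polynomial.map_add, hp, hq]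
  | monomial k r =>
    rw [Polynomial.map_monomial, Polynomial.aeval_monomial, Polynomial.aeval_monomial,
      ← Algebra.smul_def, ← Algebra.smul_def, extMap_smul, map_pow]
    rfl

variable [FiniteDimensional F A]

theorem norm_extMap (f : R →ₐ[F] S) (x : R ⊗[F] A) :
    Algebra.norm S (extMap A f x) = f (Algebra.norm R x) := by
  let b := Module.finBasis F A
  have hrepr : ∀ (z : R ⊗[F] A) i, (b.baseChange S).repr (extMap A f z) i =
      f ((b.baseChange R).repr z i) := fun z i => by
    induction z with
    | zero => simp
    | add y z hy hz => simp only [map_add, Finsupp.add_apply, hy, hz]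
    | tmul r a => rw [extMap_tmul]; simp
  rw [Algebra.norm_eq_matrix_det (b.baseChange S), Algebra.norm_eq_matrix_det (b.baseChange R)]
  change _ = (f : R →+* S) _
  rw [RingHom.map_det]
  congr 1
  ext i j
  rw [RingHom.mapMatrix_apply, Matrix.map_apply, Algebra.leftMulMatrix_eq_repr_mul,
    Algebra.leftMulMatrix_eq_repr_mul]
  change _ = f _
  rw [← hrepr, map_mul (extMap A f)]
  simp [extMap_tmul]

theorem isUnit_norm_iff (x : R ⊗[F] A) : IsUnit (Algebra.norm R x) ↔ IsUnit x := by
  refine ⟨fun h => ?_, fun h => h.map _⟩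
  rw [Algebra.norm_apply] at h
  let e := LinearEquiv.ofIsUnitDet (v := Module.finBasis F A |>.baseChange R)
    (v' := Module.finBasis F A |>.baseChange R) (f := Algebra.lmul R (R ⊗[F] A) x) (by
      rwa [LinearMap.det_toMatrix])
  have he : ∀ z, e z = x * z := fun z => rfl
  have h1 : x * e.symm 1 = 1 := by rw [← he, e.apply_symm_apply]
  have h2 : e.symm 1 * x = 1 := by
    apply e.injective
    rw [he, he, ← mul_assoc, h1, one_mul, mul_one]
  exact ⟨⟨x, e.symm 1, h1, h2⟩, rfl⟩

end ScalarExtension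

/-- If a linear combination over an extension of an infinite field `K` is a unit, so is a linear
combination over `K`: the norm of the general linear combination is a nonzero polynomial. -/
theorem exists_isUnit_sum_smul {F : Type u} [Field F] {A : Type u} [Ring A] [Algebra F A]
    [FiniteDimensional F A] {K L : Type u} [Field K] [Infinite K] [Field L] [Algebra F K]
    [Algebra F L] [Algebra K L] [IsScalarTower F K L] {r : ℕ} (z : Fin r → K ⊗[F] A)
    (l : Fin r → L) (h : IsUnit (∑ i, l i • extMap A (IsScalarTower.toAlgHom F K L) (z i))) :
    ∃ t : Fin r → K, IsUnit (∑ i, t i • z i) := by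
  let Q := MvPolynomial (Fin r) K
  let Z : Q ⊗[F] A :=
    ∑ i, (MvPolynomial.X i : Q) • extMap A (IsScalarTower.toAlgHom F K Q) (z i)
  have hZ : ∀ (M : Type u) [Field M] [Algebra F M] [Algebra K M] [IsScalarTower F K M]
      (t : Fin r → M), extMap A ((MvPolynomial.aeval t : Q →ₐ[K] M).restrictScalars F) Z =
        ∑ i, t i • extMap A (IsScalarTower.toAlgHom F K M) (z i) := by
    intro M _ _ _ _ t
    rw [map_sum]
    refine Finset.sum_congr rfl fun i _ => ?_
    rw [extMap_smul, ← extMap_comp]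
    have h1 : ((MvPolynomial.aeval t : Q →ₐ[K] M).restrictScalars F).comp
        (IsScalarTower.toAlgHom F K Q) = IsScalarTower.toAlgHom F K M := by
      ext k; simp [Q]
    rw [h1]
    simp
  have h0 : Algebra.norm Q Z ≠ 0 := fun h0 => by
    rw [← hZ, ← isUnit_norm_iff, norm_extMap, h0, map_zero] at h
    exact not_isUnit_zero h
  obtain ⟨t, ht⟩ : ∃ t : Fin r → K, MvPolynomial.eval t (Algebra.norm Q Z) ≠ 0 := by
    by_contra! hcon
    exact h0 (MvPolynomial.funext fun t => by rw [hcon, map_zero])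
  refine ⟨t, ?_⟩
  have h1 := hZ K t
  have h3 : IsScalarTower.toAlgHom F K K = AlgHom.id F K := rfl
  simp only [h3, extMap_id] at h1
  rw [← h1, ← isUnit_norm_iff, norm_extMap]
  exact isUnit_iff_ne_zero.2 ht

/-! ### Subalgebras of type `[2, …, 2]` come from the parameter space -/

/-- A polynomial in `∑ rᵢ eᵢ`, for complete orthogonal idempotents `eᵢ`. -/
theorem CompleteOrthogonalIdempotents.aeval_sum_smul {K B : Type*} [Field K] [Ring B] [Algebra K B]
    {m : ℕ} {e : Fin m → B} (he : CompleteOrthogonalIdempotents e) (r : Fin m → K)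
    (f : Polynomial K) : Polynomial.aeval (∑ i, r i • e i) f = ∑ i, f.eval (r i) • e i := by
  induction f using Polynomial.induction_on' with
  | add p q hp hq => simp only [map_add, Polynomial.eval_add, add_smul, hp, hq,
      Finset.sum_add_distrib]
  | monomial k a =>
    have h : (∑ i, r i • e i) ^ k = ∑ i, r i ^ k • e i := by
      induction k with
      | zero => simp [he.complete]
      | succ k ih =>
        rw [pow_succ, ih, Finset.sum_mul]
        refine Finset.sum_congr rfl fun i _ => ?_
        rw [Finset.mul_sum, Finset.sum_eq_single i]
        · rw [smul_mul_smul_comm, he.idem i, pow_succ]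
        · intro j _ hj
          rw [smul_mul_smul_comm, he.ortho hj.symm, smul_zero]
        · simp
    rw [Polynomial.aeval_monomial, h, ← Algebra.smul_def, Finset.smul_sum]
    simp [smul_smul]

theorem CompleteOrthogonalIdempotents.mul_sum_smul {K B : Type*} [Field K] [Ring B] [Algebra K B]
    {m : ℕ} {e : Fin m → B} (he : CompleteOrthogonalIdempotents e) (r : Fin m → K) (i : Fin m) :
    e i * ∑ j, r j • e j = r i • e i := by
  rw [Finset.mul_sum, Finset.sum_eq_single i]
  · rw [mul_smul_comm, he.idem i]
  · intro j _ hj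
    rw [mul_smul_comm, he.ortho hj.symm, smul_zero]
  · simp

section Surjectivity

variable {F : Type u} [Field F] {A : Type u} [Ring A] [Algebra F A]
variable {K L : Type u} [Field K] [Field L] [Algebra F K] [Algebra F L]
  [Algebra K L] [IsScalarTower F K L]

/-- `extMap` as a linear map. -/
noncomputable def extLinearMap (A : Type u) [Ring A] [Algebra F A] :
    K ⊗[F] A →ₗ[K] L ⊗[F] A where
  toFun := extMap A (IsScalarTower.toAlgHom F K L)
  map_add' := map_add _
  map_smul' k x := by
    rw [extMap_smul, IsScalarTower.coe_toAlgHom', algebraMap_smul, RingHom.id_apply]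

/-- The coordinates with respect to nonzero complete orthogonal idempotents extend to functionals on
the whole algebra. -/
theorem CompleteOrthogonalIdempotents.exists_dual {K B : Type*} [Field K] [Ring B] [Algebra K B]
    {m : ℕ} {e : Fin m → B} (he : CompleteOrthogonalIdempotents e) (he0 : ∀ i, e i ≠ 0) :
    ∃ χ : Fin m → Module.Dual K B, ∀ i (c : Fin m → K), χ i (∑ k, c k • e k) = c i := by
  choose δ hδ using fun i => Module.Projective.exists_dual_eq_one K (he0 i)
  refine ⟨fun i => (δ i).comp (LinearMap.mulLeft K (e i)), fun i c => ?_⟩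
  rw [LinearMap.comp_apply, LinearMap.mulLeft_apply, he.mul_sum_smul, map_smul, hδ, smul_eq_mul,
    mul_one]

/-- A subalgebra over an infinite field `K` which over an extension `L` is spanned by complete
orthogonal idempotents has an element with distinct eigenvalues over `L`, since it is not a finite
union of proper subspaces. -/
theorem exists_mem_injective_eigenvalues [Infinite K] {E : Subalgebra K (K ⊗[F] A)} {m : ℕ}
    {e : Fin m → L ⊗[F] A} (he : CompleteOrthogonalIdempotents e) (he0 : ∀ i, e i ≠ 0)
    (hspan : Submodule.span L (Set.range e) =
      Subalgebra.toSubmodule (extSubalgebra (IsScalarTower.toAlgHom F K L) E)) :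
    ∃ y ∈ E, ∃ r : Fin m → L, Function.Injective r ∧
      extMap A (IsScalarTower.toAlgHom F K L) y = ∑ i, r i • e i := by
  classical
  obtain ⟨χ, hχe⟩ := he.exists_dual (K := L) he0
  let f : Fin m → (E →ₗ[K] L) := fun i =>
    ((χ i).restrictScalars K).comp ((extLinearMap A).comp (Subalgebra.toSubmodule E).subtype)
  have hf : ∀ i x, f i x = χ i (extMap A (IsScalarTower.toAlgHom F K L) x) := fun _ _ => rfl
  clear_value f
  obtain ⟨y, hy⟩ : ∃ y : E, ∀ p ∈ (Finset.univ : Finset (Fin m)).offDiag,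
      y ∉ LinearMap.ker (f p.1 - f p.2) := by
    have := Subspace.biUnion_ne_univ_of_top_notMem
      (s := (Finset.univ : Finset (Fin m)).offDiag.image fun p => LinearMap.ker (f p.1 - f p.2))
      (by
        intro h
        rw [Finset.mem_image] at h
        obtain ⟨⟨p, q⟩, hpq, htop⟩ := h
        rw [Finset.mem_offDiag] at hpq
        have h0 : f p - f q = 0 := LinearMap.ker_eq_top.1 htop
        have h1 : Subalgebra.toSubmodule (extSubalgebra (IsScalarTower.toAlgHom F K L) E) ≤
            LinearMap.ker (χ p - χ q) := by
          rw [extSubalgebra_toSubmodule, Submodule.span_le]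
          rintro _ ⟨x, hx, rfl⟩
          have := LinearMap.congr_fun h0 ⟨x, hx⟩
          rw [LinearMap.sub_apply, hf, hf] at this
          exact this
        have h3 : e p ∈ LinearMap.ker (χ p - χ q) :=
          h1 (by rw [← hspan]; exact Submodule.subset_span ⟨p, rfl⟩)
        have h4 : e p = ∑ k, (Pi.single p 1 : Fin m → L) k • e k := by
          rw [Finset.sum_eq_single p]
          · simp
          · intro k _ hk; rw [Pi.single_eq_of_ne hk, zero_smul]
          · simp
        rw [LinearMap.mem_ker, LinearMap.sub_apply, h4, hχe, hχe, Pi.single_eq_same,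
          Pi.single_eq_of_ne hpq.2.2.symm, sub_zero] at h3
        exact one_ne_zero h3)
    rw [Set.ne_univ_iff_exists_notMem] at this
    obtain ⟨x, hx⟩ := this
    refine ⟨x, fun r hr hxr => hx ?_⟩
    simp only [Finset.mem_image, Set.mem_iUnion]
    exact ⟨_, ⟨r, hr, rfl⟩, hxr⟩
  have h1 : extMap A (IsScalarTower.toAlgHom F K L) (y : K ⊗[F] A) ∈
      Submodule.span L (Set.range e) := by
    rw [hspan]; exact extMap_mem _ y.2
  obtain ⟨r, hr⟩ := (Submodule.mem_span_range_iff_exists_fun L).1 h1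
  refine ⟨y, y.2, r, fun p q hpq => ?_, hr.symm⟩
  by_contra hne
  refine hy (p, q) (by simp [hne]) ?_
  rw [LinearMap.mem_ker, LinearMap.sub_apply, hf, hf, ← hr, hχe, hχe, hpq, sub_self]

/-- An element with distinct eigenvalues over `L` generates the subalgebra: over `L` the elements
are polynomials in it by interpolation, and these expressions can be sliced. -/
theorem eq_adjoin_of_injective_eigenvalues {E : Subalgebra K (K ⊗[F] A)} {m : ℕ}
    {e : Fin m → L ⊗[F] A} (he : CompleteOrthogonalIdempotents e)
    (hspan : Submodule.span L (Set.range e) =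
      Subalgebra.toSubmodule (extSubalgebra (IsScalarTower.toAlgHom F K L) E))
    {y : K ⊗[F] A} (hy : y ∈ E) {r : Fin m → L} (hr : Function.Injective r)
    (hyr : extMap A (IsScalarTower.toAlgHom F K L) y = ∑ i, r i • e i) :
    E = Algebra.adjoin K {y} := by
  refine le_antisymm (fun x hx => ?_) (Algebra.adjoin_le (by rintro _ rfl; exact hy))
  obtain ⟨π, hπ⟩ := Module.Projective.exists_dual_eq_one K (one_ne_zero (α := L))
  have h1 : extMap A (IsScalarTower.toAlgHom F K L) x ∈ Submodule.span L (Set.range e) := by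
    rw [hspan]; exact extMap_mem _ hx
  obtain ⟨c, hc⟩ := (Submodule.mem_span_range_iff_exists_fun L).1 h1
  obtain ⟨g, hg⟩ : ∃ g : Polynomial L, extMap A (IsScalarTower.toAlgHom F K L) x =
      Polynomial.aeval (extMap A (IsScalarTower.toAlgHom F K L) y) g := by
    refine ⟨Lagrange.interpolate Finset.univ r c, ?_⟩
    rw [hyr, he.aeval_sum_smul, ← hc]
    refine Finset.sum_congr rfl fun i _ => ?_
    rw [Lagrange.eval_interpolate_at_node _ hr.injOn (Finset.mem_univ i)]
  have h3 : x = slice A π (extMap A (IsScalarTower.toAlgHom F K L) x) := by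
    have := slice_smul_extMap π (1 : L) x
    rwa [one_smul, hπ, one_smul, eq_comm] at this
  have h4 : ∀ k, slice A π (g.coeff k • extMap A (IsScalarTower.toAlgHom F K L) y ^ k) =
      π (g.coeff k) • y ^ k := fun k => by
    rw [← map_pow, slice_smul_extMap]
  have h5 : x = ∑ k ∈ Finset.range (g.natDegree + 1), π (g.coeff k) • y ^ k := by
    rw [h3, hg, Polynomial.aeval_eq_sum_range, map_sum]
    exact Finset.sum_congr rfl fun k _ => h4 k
  rw [h5]
  exact Subalgebra.sum_mem _ fun k _ =>
    Subalgebra.smul_mem _ (Subalgebra.pow_mem _ (Algebra.self_mem_adjoin_singleton K y) k) _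

end Surjectivity

section Surjectivity

open Matrix

variable {F : Type u} [Field F] {A : Type u} [Ring A] [Algebra F A] {m : ℕ} {ℓ₁ ℓ₂ : A →ₗ[F] A}

/-- For commuting idempotents of rank two over an algebraically closed field there is an invertible
element `z` of the first skew space such that `y z` is in it for every combination `y` of the
idempotents. -/
theorem exists_isUnit_lTensor_eq_zero (hℓ : IsSkewPair (2 * m) ℓ₁ ℓ₂) (hm : m ≠ 0) {L : Type u}
    [Field L] [Algebra F L] [IsAlgClosed L] {e : Fin m → L ⊗[F] A}
    (he : CompleteOrthogonalIdempotents e) (hr : ∀ i, reducedRank L (L ⊗[F] A) (e i) = 2)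
    (r : Fin m → L) :
    ∃ z : L ⊗[F] A, IsUnit z ∧ ℓ₁.lTensor L z = 0 ∧ ℓ₁.lTensor L ((∑ i, r i • e i) * z) = 0 := by
  obtain ⟨ψ, b, b', hb, hb', h₁, -⟩ := hℓ L
  have hψe : CompleteOrthogonalIdempotents (fun i => ψ (e i)) := he.map ψ.toRingHom
  obtain ⟨v, hvu, hv, hev⟩ := hψe.exists_skew fun i => by
    rw [← reducedRank_eq_rank (by omega) ψ, hr]
  have hvb : v * b' * b = v := by rw [Matrix.mul_assoc, hb', Matrix.mul_one]
  refine ⟨ψ.symm (v * b'), ?_, ?_, ?_⟩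
  · exact (hvu.mul (IsUnit.of_mul_eq_one b hb')).map ψ.symm
  · rw [h₁, ψ.apply_symm_apply, hvb, hv]
  · rw [h₁, map_mul, ψ.apply_symm_apply, Matrix.mul_assoc, hvb, transpose_mul, hv, Matrix.neg_mul,
      map_sum, transpose_sum, Finset.mul_sum, Finset.sum_mul]
    simp only [map_smul, transpose_smul, Matrix.mul_smul, Matrix.smul_mul, hev]

/-- If `u` and `y u` are in the first skew space and `u` is a unit, then `u⁻¹ y` is in the second
one. -/
theorem lTensor_eq_zero_of_mul (hℓ : IsSkewPair (2 * m) ℓ₁ ℓ₂) {L : Type u}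
    [Field L] [Algebra F L] [IsAlgClosed L] {u u' y : L ⊗[F] A} (huu' : u * u' = 1)
    (hu'u : u' * u = 1) (hu : ℓ₁.lTensor L u = 0) (hyu : ℓ₁.lTensor L (y * u) = 0) :
    ℓ₂.lTensor L (u' * y) = 0 := by
  obtain ⟨ψ, b, b', hb, hb', h₁, h₂⟩ := hℓ L
  rw [h₁] at hu hyu
  rw [h₂]
  have e1 : ψ u * ψ u' = 1 := by rw [← map_mul, huu', map_one]
  have e2 : ψ u' * ψ u = 1 := by rw [← map_mul, hu'u, map_one]
  rw [map_mul] at hyu ⊢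
  rw [Matrix.mul_assoc, transpose_mul, hu, Matrix.neg_mul, neg_inj] at hyu
  set v := ψ u * b with hv
  set v' := b' * ψ u' with hv'
  have hvv' : v * v' = 1 := by
    rw [hv, hv', Matrix.mul_assoc, ← Matrix.mul_assoc b, hb, Matrix.one_mul, e1]
  have hv'v : v' * v = 1 := by
    rw [hv, hv', Matrix.mul_assoc, ← Matrix.mul_assoc (ψ u'), e2, Matrix.one_mul, hb']
  have hv't : v'ᵀ = -v' := by
    have h1 : v'ᵀ * v = -1 := by
      rw [← neg_inj, neg_neg, ← Matrix.mul_neg, ← hu, ← transpose_mul, hvv', transpose_one]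
    rw [← Matrix.mul_one v'ᵀ, ← hvv', ← Matrix.mul_assoc, h1, Matrix.neg_mul, Matrix.one_mul]
  have h3 := congrArg (fun x => v' * (x * v')) hyu
  simp only [Matrix.mul_assoc, hvv', Matrix.mul_one] at h3
  rw [← Matrix.mul_assoc v', hv'v, Matrix.one_mul] at h3
  rw [← Matrix.mul_assoc, ← hv', transpose_mul, hv't, Matrix.mul_neg, h3]

variable [FiniteDimensional F A] {K : Type u} [Field K] [Infinite K] [Algebra F K]

/-- Every subalgebra of type `[2, …, 2]` over an infinite field is generated by a product `u s` of
elements of the two skew spaces, with `u` invertible. The monic polynomials of degree `m`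
annihilating this generator are separable, and no monic polynomial of smaller degree does. -/
theorem exists_eq_adjoin_mul (hℓ : IsSkewPair (2 * m) ℓ₁ ℓ₂) (hm : m ≠ 0)
    {E : Subalgebra K (K ⊗[F] A)} (hE : HasType E (Multiset.replicate m 2)) :
    ∃ u s : K ⊗[F] A, IsUnit u ∧ ℓ₁.lTensor K u = 0 ∧ ℓ₂.lTensor K s = 0 ∧
      E = Algebra.adjoin K {u * s} ∧
      ∀ P : Polynomial K, P.Monic → Polynomial.aeval (u * s) P = 0 →
        m ≤ P.natDegree ∧ (P.natDegree = m → P.Separable) := by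
  let L := AlgebraicClosure K
  let j : K →ₐ[F] L := IsScalarTower.toAlgHom F K L
  have hj : Function.Injective j := FaithfulSMul.algebraMap_injective K L
  obtain ⟨k, e, he, he0, hspan, htype⟩ := hE L j
  have hk : k = m := by simpa using congrArg Multiset.card htype
  subst hk
  have hr : ∀ i, reducedRank L (L ⊗[F] A) (e i) = 2 := fun i => by
    apply Multiset.eq_of_mem_replicate (n := k)
    rw [← htype]
    exact Multiset.mem_map.2 ⟨i, Finset.mem_univ_val i, rfl⟩
  obtain ⟨y, hy, r, hrinj, hyr⟩ := exists_mem_injective_eigenvalues he he0 hspan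
  have hEy := eq_adjoin_of_injective_eigenvalues he hspan hy hrinj hyr
  obtain ⟨z, hz, hz1, hz2⟩ := exists_isUnit_lTensor_eq_zero hℓ hm he hr r
  rw [← hyr] at hz2
  obtain ⟨p, l, π, hsum⟩ := exists_eq_sum_slice (K := K) z
  rw [hsum] at hz
  obtain ⟨t, ht⟩ := exists_isUnit_sum_smul _ l hz
  let u := ∑ i, t i • slice A (π i) z
  have hu : ℓ₁.lTensor K u = 0 := by
    rw [map_sum]
    refine Finset.sum_eq_zero fun i _ => ?_
    rw [lTensor_smul, ← slice_lTensor, hz1, map_zero, smul_zero]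
  have hyu : ℓ₁.lTensor K (y * u) = 0 := by
    rw [Finset.mul_sum, map_sum]
    refine Finset.sum_eq_zero fun i _ => ?_
    rw [mul_smul_comm, lTensor_smul, ← slice_extMap_mul, ← slice_lTensor, hz2, map_zero, smul_zero]
  obtain ⟨⟨u₀, u', huu', hu'u⟩, hu₀⟩ := ht
  change u₀ = u at hu₀
  rw [← hu₀] at hu hyu
  have hus : u₀ * (u' * y) = y := by rw [← mul_assoc, huu', one_mul]
  refine ⟨u₀, u' * y, ⟨⟨u₀, u', huu', hu'u⟩, rfl⟩, hu, ?_, by rw [hus]; exact hEy, ?_⟩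
  · apply extMap_injective hj
    rw [extMap_lTensor, map_zero, map_mul]
    refine lTensor_eq_zero_of_mul hℓ (u := extMap A j u₀) ?_ ?_ ?_ ?_
    · rw [← map_mul, huu', map_one]
    · rw [← map_mul, hu'u, map_one]
    · rw [← extMap_lTensor, hu, map_zero]
    · rw [← map_mul, ← extMap_lTensor, hyu, map_zero]
  · intro P hP hyP
    rw [hus] at hyP
    have h1 := congrArg (extMap A j) hyP
    rw [map_zero, extMap_aeval, hyr, he.aeval_sum_smul] at h1
    have hroot : ∀ i, (P.map (j : K →+* L)).eval (r i) = 0 := fun i => by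
      have h3 := congrArg (e i * ·) h1
      simp only [he.mul_sum_smul, mul_zero] at h3
      exact (smul_eq_zero.1 h3).resolve_right (he0 i)
    have hPm : (P.map (j : K →+* L)).Monic := hP.map _
    have hdeg : (P.map (j : K →+* L)).natDegree = P.natDegree := hP.natDegree_map _
    have hle : k ≤ P.natDegree := by
      by_contra! hlt
      refine hPm.ne_zero (Polynomial.eq_zero_of_degree_lt_of_eval_index_eq_zero
        Finset.univ hrinj.injOn ?_ fun i _ => hroot i)
      rw [Polynomial.degree_eq_natDegree hPm.ne_zero, hdeg]
      simpa using hlt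
    refine ⟨hle, fun hPk => ?_⟩
    rw [← Polynomial.separable_map (j : K →+* L)]
    have : P.map (j : K →+* L) = ∏ i, (Polynomial.X - Polynomial.C (r i)) := by
      refine Polynomial.eq_of_degree_sub_lt_of_eval_index_eq Finset.univ hrinj.injOn
        ?_ fun i _ => ?_
      · refine (Polynomial.degree_sub_lt_left ?_ hPm.ne_zero ?_).trans_eq ?_
        · rw [Polynomial.degree_prod, Polynomial.degree_eq_natDegree hPm.ne_zero, hdeg, hPk]
          simp
        · rw [hPm.leadingCoeff, (Polynomial.monic_prod_X_sub_C r _).leadingCoeff]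
        · rw [Polynomial.degree_eq_natDegree hPm.ne_zero, hdeg, hPk]
          simp
      · rw [hroot, Polynomial.eval_prod, Finset.prod_eq_zero (Finset.mem_univ i)]
        simp
    rw [this, Polynomial.separable_prod_X_sub_C_iff]
    exact hrinj

end Surjectivity

/-! ### Étale subalgebras generated by a product -/

section Generic

open Polynomial

/-- The degree of the derivative may drop under the specialization `φ`, but since `P` is monic this
does not change the resultant. -/
theorem Polynomial.Monic.isUnit_map_resultant_iff {R S : Type*} [CommRing R] [CommRing S]
    {P : R[X]} (hP : P.Monic) (φ : R →+* S) :
    IsUnit (φ (resultant P P.derivative)) ↔ (P.map φ).Separable := by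
  nontriviality S
  have hdeg : (P.map φ).natDegree = P.natDegree := hP.natDegree_map φ
  have hle : (P.map φ).derivative.natDegree ≤ P.derivative.natDegree := by
    rw [derivative_map]; exact natDegree_map_le
  obtain ⟨k, hk⟩ := Nat.exists_eq_add_of_le hle
  rw [separable_def, ← isUnit_resultant_iff_isCoprime (hP.map φ), ← resultant_map_map, hk,
    resultant_add_right_deg _ _ _ _ _ (by rw [derivative_map]), ← hdeg,
    (hP.map φ).coeff_natDegree, one_pow, one_mul, derivative_map]

/-- Adjoining a root of a separable monic polynomial is standard étale, with nothing inverted. -/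
theorem etale_adjoinRoot {R : Type*} [CommRing R] {P : R[X]} (hP : P.Monic) (hs : P.Separable) :
    Algebra.Etale R (AdjoinRoot P) := by
  obtain ⟨a, b, hab⟩ := hs
  let Q : StandardEtalePair R :=
    ⟨P, hP, 1, b, a, 1, by rw [pow_one, ← hab]; ring⟩
  have h1 : IsUnit (AdjoinRoot.mk P (1 : R[X])) := by rw [map_one]; exact isUnit_one
  let e : AdjoinRoot P ≃ₐ[AdjoinRoot P] Localization.Away (AdjoinRoot.mk Q.f Q.g) :=
    IsLocalization.atUnit _ _ (AdjoinRoot.mk P 1) h1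
  exact Algebra.Etale.of_equiv (Q.equivAwayAdjoinRoot.trans (e.restrictScalars R).symm)

variable {F : Type u} [Field F] {A : Type u} [Ring A] [Algebra F A]

/-- `R`-linear functionals on `A_R` extend along `x : R → S`. -/
theorem exists_extend_functional {R S : Type u} [CommRing R] [Algebra F R] [CommRing S]
    [Algebra F S] (x : R →ₐ[F] S) (φ : R ⊗[F] A →ₗ[R] R) :
    ∃ Φ : S ⊗[F] A →ₗ[S] S, ∀ z, Φ (extMap A x z) = x (φ z) := by
  let l : A →ₗ[F] S := x.toLinearMap ∘ₗ (φ.restrictScalars F) ∘ₗ (TensorProduct.mk F R A 1)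
  refine ⟨l.liftBaseChange S, fun z => ?_⟩
  induction z with
  | zero => simp
  | add y z hy hz => simp only [map_add, hy, hz]
  | tmul r a =>
    rw [extMap_tmul, LinearMap.liftBaseChange_tmul]
    change x r • x (φ (1 ⊗ₜ a)) = _
    rw [smul_eq_mul, ← map_mul, ← smul_eq_mul r, ← map_smul, TensorProduct.smul_tmul', smul_eq_mul,
      mul_one]

/-- The elements killed by `ℓ` after any scalar extension are the combinations of a basis of the
kernel of `ℓ`. -/
theorem exists_basis_ker_lTensor [FiniteDimensional F A] (ℓ : A →ₗ[F] A) :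
    ∃ (d : ℕ) (b : Fin d → A), (∀ i, ℓ (b i) = 0) ∧
      ∀ (K : Type u) [Field K] [Algebra F K] (x : K ⊗[F] A), ℓ.lTensor K x = 0 →
        ∃ c : Fin d → K, x = ∑ i, c i ⊗ₜ b i := by
  let b := Module.finBasis F (LinearMap.ker ℓ)
  refine ⟨_, fun i => (b i : A), fun i => (b i).2, fun K _ _ x hx => ?_⟩
  have h1 : x ∈ LinearMap.ker (TensorProduct.AlgebraTensorModule.lTensor K K ℓ) := hx
  rw [Module.Flat.ker_lTensor_eq] at h1
  obtain ⟨z, rfl⟩ := h1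
  refine ⟨fun i => (b.baseChange K).repr z i, ?_⟩
  conv_lhs => rw [← (b.baseChange K).sum_repr z]
  rw [map_sum]
  refine Finset.sum_congr rfl fun i _ => ?_
  rw [map_smul, Module.Basis.baseChange_apply]
  change _ • (1 ⊗ₜ (b i : A)) = _
  rw [TensorProduct.smul_tmul', smul_eq_mul, mul_one]

variable {m : ℕ} {ℓ₁ ℓ₂ : A →ₗ[F] A}

/-- The bound on the degree of `u s` descends from the algebraic closure: a linear retraction onto
the base field maps a monic relation to a monic relation. -/
theorem natDegree_minpoly_mul_le [FiniteDimensional F A] (hℓ : IsSkewPair (2 * m) ℓ₁ ℓ₂)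
    (h2 : (2 : F) ≠ 0) {K : Type u} [Field K] [Algebra F K] {u s : K ⊗[F] A} (hu : IsUnit u)
    (hu₁ : ℓ₁.lTensor K u = 0) (hs₂ : ℓ₂.lTensor K s = 0) :
    (minpoly K (u * s)).natDegree ≤ m := by
  let L := AlgebraicClosure K
  let j : K →ₐ[F] L := IsScalarTower.toAlgHom F K L
  obtain ⟨ψ, b, b', hb, hb', h₁, h₂⟩ := hℓ L
  obtain ⟨⟨u, u', huu', hu'u⟩, rfl⟩ := hu
  have h2L : (2 : L) ≠ 0 := by
    have := (map_ne_zero (algebraMap F L)).2 h2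
    rwa [map_ofNat] at this
  have hju : (ψ (extMap A j u) * b).transpose = -(ψ (extMap A j u) * b) := by
    rw [← h₁, ← extMap_lTensor]
    exact (congrArg _ hu₁).trans (map_zero _)
  have hjs : (b' * ψ (extMap A j s)).transpose = -(b' * ψ (extMap A j s)) := by
    rw [← h₂, ← extMap_lTensor, hs₂, map_zero]
  have e1 : ψ (extMap A j u) * ψ (extMap A j u') = 1 := by
    rw [← map_mul, ← map_mul, huu', map_one, map_one]
  have e2 : ψ (extMap A j u') * ψ (extMap A j u) = 1 := by
    rw [← map_mul, ← map_mul, hu'u, map_one, map_one]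
  have hle := Matrix.natDegree_minpoly_mul_skew_le h2L rfl hju hjs
    (v' := b' * ψ (extMap A j u'))
    (by rw [Matrix.mul_assoc, ← Matrix.mul_assoc b, hb, Matrix.one_mul, e1])
    (by rw [Matrix.mul_assoc, ← Matrix.mul_assoc (ψ _), e2, Matrix.one_mul, hb'])
  have hprod : ψ (extMap A j u) * b * (b' * ψ (extMap A j s)) = ψ (extMap A j (u * s)) := by
    rw [Matrix.mul_assoc, ← Matrix.mul_assoc b, hb, Matrix.one_mul, map_mul, map_mul]
  rw [hprod, minpoly.algEquiv_eq] at hle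
  set f := minpoly L (extMap A j (u * s)) with hf
  have hfm : f.Monic := minpoly.monic (Algebra.IsIntegral.isIntegral _)
  obtain ⟨π, hπ⟩ := Module.Projective.exists_dual_eq_one K (one_ne_zero : (1 : L) ≠ 0)
  have hrel : ∑ i ∈ Finset.range (f.natDegree + 1), π (f.coeff i) • (u * s) ^ i = 0 := by
    have h0 : aeval (extMap A j (u * s)) f = 0 := minpoly.aeval _ _
    rw [aeval_eq_sum_range] at h0
    have h3 := congrArg (slice A π) h0
    rw [map_zero, map_sum] at h3
    rw [← h3]
    refine Finset.sum_congr rfl fun i _ => ?_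
    rw [← map_pow, slice_smul_extMap]
  let g : K[X] := ∑ i ∈ Finset.range (f.natDegree + 1), C (π (f.coeff i)) * X ^ i
  have hgc : g.coeff f.natDegree = 1 := by
    simp only [g, finsetSum_coeff, coeff_C_mul, coeff_X_pow]
    rw [Finset.sum_eq_single f.natDegree]
    · simp [hfm.coeff_natDegree, hπ]
    · intro i _ hi
      rw [if_neg (Ne.symm hi), mul_zero]
    · simp
  have hg0 : g ≠ 0 := fun h => by simp [h] at hgc
  have hgd : g.natDegree ≤ f.natDegree := by
    refine natDegree_sum_le_of_forall_le _ _ fun i hi => ?_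
    exact (natDegree_C_mul_X_pow_le _ _).trans (Nat.lt_succ_iff.1 (Finset.mem_range.1 hi))
  have hgy : aeval (u * s) g = 0 := by
    rw [← hrel]
    simp only [g, map_sum, map_mul, aeval_C, map_pow, aeval_X, Algebra.smul_def]
  exact ((natDegree_le_natDegree (minpoly.degree_le_of_ne_zero K _ hg0 hgy)).trans hgd).trans hle

/-- If `y = u s` is annihilated by a separable monic polynomial of degree `m` and by no nonzero
polynomial of smaller degree, then `y` generates an étale subalgebra of type `[2, …, 2]`. -/
theorem isEtaleSubalgebra_and_hasType_adjoin [FiniteDimensional F A]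
    (hℓ : IsSkewPair (2 * m) ℓ₁ ℓ₂) (h2 : (2 : F) ≠ 0) (hm : m ≠ 0) {R : Type u} [CommRing R]
    [Nontrivial R] [Algebra F R] {u s : R ⊗[F] A} (hu : IsUnit u) (hu₁ : ℓ₁.lTensor R u = 0)
    (hs₂ : ℓ₂.lTensor R s = 0) {P : R[X]} (hP : P.Monic) (hdeg : P.natDegree = m)
    (hsep : P.Separable) (hy : aeval (u * s) P = 0)
    (hind : ∀ f : R[X], f.degree < m → aeval (u * s) f = 0 → f = 0) :
    IsEtaleSubalgebra (Algebra.adjoin R {u * s}) ∧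
      HasType (Algebra.adjoin R {u * s}) (Multiset.replicate m 2) := by
  have hPd : P.degree = m := by rw [degree_eq_natDegree hP.ne_zero, hdeg]
  have het := etale_adjoinRoot hP hsep
  let j : AdjoinRoot P →ₐ[R] R ⊗[F] A := Ideal.Quotient.liftₐ _ (aeval (u * s)) fun f hf => by
    obtain ⟨g, rfl⟩ := Ideal.mem_span_singleton'.1 hf
    rw [map_mul, hy, mul_zero]
  have hjmk : ∀ f, j (AdjoinRoot.mk P f) = aeval (u * s) f := fun f => rfl
  have hj : Function.Injective j := by
    rw [injective_iff_map_eq_zero]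
    intro z hz
    obtain ⟨f, rfl⟩ := AdjoinRoot.mk_surjective z
    rw [hjmk, ← modByMonic_add_div f P, map_add, map_mul, hy, zero_mul, add_zero] at hz
    have := hind _ (hPd ▸ degree_modByMonic_lt f hP) hz
    rw [AdjoinRoot.mk_eq_zero, ← modByMonic_eq_zero_iff_dvd hP, this]
  constructor
  · refine ⟨AdjoinRoot P, inferInstance, inferInstance, het, ⟨?_⟩⟩
    refine (AlgEquiv.ofInjective j hj).trans (Subalgebra.equivOfEq _ _ ?_)
    rw [Algebra.adjoin_singleton_eq_range_aeval]
    ext z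
    constructor
    · rintro ⟨w, rfl⟩
      obtain ⟨f, rfl⟩ := AdjoinRoot.mk_surjective w
      exact ⟨f, rfl⟩
    · rintro ⟨f, rfl⟩
      exact ⟨AdjoinRoot.mk P f, rfl⟩
  · intro Ω _ _ _ x
    obtain ⟨p, hp⟩ := exists_retraction j hj
    -- the coefficients of a polynomial of degree less than `m` are linear functions of its value
    choose Φ hΦ using fun k : ℕ => exists_extend_functional x
      ((lcoeff R k) ∘ₗ (AdjoinRoot.modByMonicHom hP) ∘ₗ p)
    have hΦy : ∀ k, ∀ i < m, Φ k (extMap A x (u * s) ^ i) = if k = i then 1 else 0 := by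
      intro k i hi
      rw [← map_pow, hΦ]
      have h1 : (u * s) ^ i = j (AdjoinRoot.mk P (X ^ i)) := by rw [hjmk, map_pow, aeval_X]
      have h3 : (X ^ i : R[X]) %ₘ P = X ^ i := by
        rw [modByMonic_eq_self_iff hP, hPd, degree_X_pow]
        exact_mod_cast hi
      rw [LinearMap.comp_apply, LinearMap.comp_apply, h1, hp, AdjoinRoot.modByMonicHom_mk, h3,
        lcoeff_apply, coeff_X_pow]
      split_ifs <;> simp
    have hindΩ : ∀ f : Polynomial Ω, f.degree < m → aeval (extMap A x (u * s)) f = 0 → f = 0 := by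
      intro f hf h0
      by_contra hf0
      refine hf0 (Polynomial.ext fun k => ?_)
      rw [coeff_zero]
      by_cases hk : k < m
      · have h3 := congrArg (Φ k) h0
        rw [aeval_eq_sum_range' ((natDegree_lt_iff_degree_lt hf0).2 hf)] at h3
        rw [map_zero, map_sum, Finset.sum_eq_single k] at h3
        · rwa [map_smul, hΦy k k hk, if_pos rfl, smul_eq_mul, mul_one] at h3
        · intro i hi hik
          rw [map_smul, hΦy k i (Finset.mem_range.1 hi), if_neg (Ne.symm hik), smul_zero]
        · intro h
          exact absurd (Finset.mem_range.2 hk) h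
      · exact coeff_eq_zero_of_degree_lt (hf.trans_le (by exact_mod_cast not_lt.1 hk))
    obtain ⟨ψ, b, b', hb, hb', h₁, h₂⟩ := hℓ Ω
    obtain ⟨⟨u, u', huu', hu'u⟩, rfl⟩ := hu
    have h2Ω : (2 : Ω) ≠ 0 := by
      have := (map_ne_zero (algebraMap F Ω)).2 h2
      rwa [map_ofNat] at this
    have hxu : (ψ (extMap A x u) * b).transpose = -(ψ (extMap A x u) * b) := by
      rw [← h₁, ← extMap_lTensor]
      exact (congrArg _ hu₁).trans (map_zero _)
    have hxs : (b' * ψ (extMap A x s)).transpose = -(b' * ψ (extMap A x s)) := by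
      rw [← h₂, ← extMap_lTensor, hs₂, map_zero]
    obtain ⟨e, he, he0, hspan, hr⟩ := exists_idempotents_of_skew_product h2Ω hm rfl ψ
      (y := extMap A x (u * s)) (v' := b' * ψ (extMap A x u')) hxu hxs
      (by
        rw [Matrix.mul_assoc, ← Matrix.mul_assoc b, hb, Matrix.one_mul, ← map_mul, ← map_mul, huu',
          map_one, map_one])
      (by rw [Matrix.mul_assoc, ← Matrix.mul_assoc b, hb, Matrix.one_mul, map_mul, map_mul])
      (hP.map (x : R →+* Ω)) (by rw [hP.natDegree_map, hdeg]) (hsep.map)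
      (by rw [← extMap_aeval]; exact (congrArg _ hy).trans (map_zero _)) hindΩ
    refine ⟨m, e, he, he0, ?_, ?_⟩
    · rw [extSubalgebra_adjoin_singleton]
      exact hspan
    · rw [funext hr]
      simp

end Generic

/-! ### The generic subalgebra -/

section GenericPoint

open Polynomial

variable {F : Type u} [Field F] {A : Type u} [Ring A] [Algebra F A] [FiniteDimensional F A]

/-- The monic minimal relation of an element over the fraction field of an integrally closed
domain has coefficients in the domain. -/
theorem exists_monic_map_eq_minpoly {R₀ : Type u} [CommRing R₀] [IsDomain R₀]
    [IsIntegrallyClosed R₀] [Algebra F R₀] {K : Type u} [Field K] [Algebra R₀ K]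
    [IsFractionRing R₀ K] [Algebra F K] [IsScalarTower F R₀ K] (y : R₀ ⊗[F] A) :
    ∃ P : R₀[X], P.Monic ∧ aeval y P = 0 ∧
      P.map (algebraMap R₀ K) = minpoly K (extMap A (IsScalarTower.toAlgHom F R₀ K) y) := by
  let j : R₀ →ₐ[F] K := IsScalarTower.toAlgHom F R₀ K
  have hj : Function.Injective j := IsFractionRing.injective R₀ K
  obtain ⟨g, hg, hgy⟩ := IsIntegral.of_finite R₀ y
  have hgy' : aeval y g = 0 := hgy
  have hdvd : minpoly K (extMap A j y) ∣ g.map (algebraMap R₀ K) := by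
    apply minpoly.dvd
    have := extMap_aeval j y g
    rw [hgy', map_zero] at this
    exact this.symm
  obtain ⟨P, hP⟩ := IsIntegrallyClosed.eq_map_mul_C_of_dvd K hg hdvd
  have hmm : (minpoly K (extMap A j y)).Monic := minpoly.monic (IsIntegral.of_finite K _)
  rw [hmm.leadingCoeff, C_1, mul_one] at hP
  have hinj : Function.Injective (extMap A j) := by
    have : (extMap A j : R₀ ⊗[F] A → K ⊗[F] A) = j.toLinearMap.rTensor A := rfl
    rw [this]
    exact Module.Flat.rTensor_preserves_injective_linearMap _ hj
  refine ⟨P, ?_, ?_, hP⟩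
  · rw [Function.Injective.monic_map_iff (IsFractionRing.injective R₀ K), hP]
    exact hmm
  · apply hinj
    rw [extMap_aeval, map_zero]
    have : P.map (j : R₀ →+* K) = minpoly K (extMap A j y) := hP
    rw [this, minpoly.aeval]

/-- If subalgebras of type `[2, …, 2]` exist at all, there is a family of such étale subalgebras
over a principal open subset of an affine space which contains all of those over
infinite fields: the subalgebras generated by the products `u s` in the two skew spaces. -/
theorem exists_generic_point [Algebra.IsCentral F A] [IsSimpleRing A] (h2 : (2 : F) ≠ 0)
    (hs : IsSplitAlgebra F (A ⊗[F] A)) {m : ℕ} (hdeg : csaDegree F A = 2 * m) (hm : m ≠ 0)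
    {K₀ : Type u} [Field K₀] [Infinite K₀] [Algebra F K₀]
    (p₀ : (et F A m).obj (CommAlgCat.of F K₀)) :
    ∃ (d : ℕ) (D : MvPolynomial (Fin d) F)
      (ξ : (et F A m).obj (CommAlgCat.of F (Localization.Away D))),
      ∀ (K : Type u) [Field K] [Infinite K] [Algebra F K] (p : (et F A m).obj (CommAlgCat.of F K)),
        ∃ x : Localization.Away D →ₐ[F] K, (et F A m).map (CommAlgCat.ofHom x) ξ = p := by
  obtain ⟨ℓ₁, ℓ₂, hℓ⟩ := exists_isSkewPair h2 hs
  rw [hdeg] at hℓ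
  have htype : csaDegree F A / m = 2 := by
    rw [hdeg]; exact Nat.mul_div_cancel _ (Nat.pos_of_ne_zero hm)
  obtain ⟨d₁, b₁, hb₁, hker₁⟩ := exists_basis_ker_lTensor ℓ₁
  obtain ⟨d₂, b₂, hb₂, hker₂⟩ := exists_basis_ker_lTensor ℓ₂
  let R₀ := MvPolynomial (Fin (d₁ + d₂)) F
  let u : R₀ ⊗[F] A := ∑ i, (MvPolynomial.X (Fin.castAdd d₂ i) : R₀) ⊗ₜ b₁ i
  let s : R₀ ⊗[F] A := ∑ i, (MvPolynomial.X (Fin.natAdd d₁ i) : R₀) ⊗ₜ b₂ i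
  have hu₁ : ℓ₁.lTensor R₀ u = 0 := by
    simp only [u, map_sum, LinearMap.lTensor_tmul, hb₁, TensorProduct.tmul_zero,
      Finset.sum_const_zero]
  have hs₂ : ℓ₂.lTensor R₀ s = 0 := by
    simp only [s, map_sum, LinearMap.lTensor_tmul, hb₂, TensorProduct.tmul_zero,
      Finset.sum_const_zero]
  -- every subalgebra over an infinite field comes from a specialization of `u` and `s`
  have hspec : ∀ (K : Type u) [Field K] [Infinite K] [Algebra F K]
      (p : (et F A m).obj (CommAlgCat.of F K)), ∃ v : R₀ →ₐ[F] K,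
        IsUnit (extMap A v u) ∧ p.1 = Algebra.adjoin K {extMap A v (u * s)} ∧
        ∀ P : Polynomial K, P.Monic → aeval (extMap A v (u * s)) P = 0 →
          m ≤ P.natDegree ∧ (P.natDegree = m → P.Separable) := by
    intro K _ _ _ p
    have hp : ∀ k, csaDegree F A / m = k → HasType p.1 (Multiset.replicate m k) := by
      rintro _ rfl
      exact p.2.2
    obtain ⟨u', s', hu', hu'₁, hs'₂, hE, hP⟩ := exists_eq_adjoin_mul hℓ hm (hp 2 htype)
    obtain ⟨c₁, rfl⟩ := hker₁ K u' hu'₁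
    obtain ⟨c₂, rfl⟩ := hker₂ K s' hs'₂
    let v : R₀ →ₐ[F] K := MvPolynomial.aeval (Fin.append c₁ c₂)
    have hv : ∀ i, v (MvPolynomial.X i) = Fin.append c₁ c₂ i := MvPolynomial.aeval_X _
    have hvu : extMap A v u = ∑ i, c₁ i ⊗ₜ b₁ i := by
      rw [map_sum]
      exact Finset.sum_congr rfl fun i _ => by rw [extMap_tmul, hv, Fin.append_left]
    have hvs : extMap A v s = ∑ i, c₂ i ⊗ₜ b₂ i := by
      rw [map_sum]
      exact Finset.sum_congr rfl fun i _ => by rw [extMap_tmul, hv, Fin.append_right]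
    refine ⟨v, ?_, ?_, ?_⟩
    · rwa [hvu]
    · rwa [map_mul, hvu, hvs]
    · rwa [map_mul, hvu, hvs]
  clear_value u s
  let Q := FractionRing R₀
  let j : R₀ →ₐ[F] Q := IsScalarTower.toAlgHom F R₀ Q
  have hj : Function.Injective j := IsFractionRing.injective R₀ Q
  obtain ⟨P, hP, hPy, hPQ⟩ := exists_monic_map_eq_minpoly (K := Q) (u * s)
  obtain ⟨v₀, hv₀u, -, hv₀⟩ := hspec K₀ p₀
  have hN : ∀ {K : Type u} [Field K] [Algebra F K] (v : R₀ →ₐ[F] K), IsUnit (extMap A v u) →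
      v (Algebra.norm R₀ u) ≠ 0 := by
    intro K _ _ v h
    rw [← norm_extMap]
    exact ((isUnit_norm_iff _).2 h).ne_zero
  have hN0 : Algebra.norm R₀ u ≠ 0 := fun h => hN v₀ hv₀u (by rw [h, map_zero])
  have hvP : ∀ {K : Type u} [Field K] [Algebra F K] (v : R₀ →ₐ[F] K),
      aeval (extMap A v (u * s)) (P.map (v : R₀ →+* K)) = 0 := by
    intro K _ _ v
    rw [← extMap_aeval, hPy, map_zero]
  -- the upper bound holds at the generic point, the lower bound at the given special one
  have hPdeg : P.natDegree = m := by
    apply le_antisymm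
    · rw [← hP.natDegree_map (algebraMap R₀ Q), hPQ, map_mul]
      refine natDegree_minpoly_mul_le hℓ h2 ?_ ?_ ?_
      · rw [← isUnit_norm_iff, norm_extMap]
        exact (map_ne_zero_iff j hj |>.2 hN0).isUnit
      · rw [← extMap_lTensor, hu₁, map_zero]
      · rw [← extMap_lTensor, hs₂, map_zero]
    · rw [← hP.natDegree_map (v₀ : R₀ →+* K₀)]
      exact (hv₀ _ (hP.map _) (hvP v₀)).1
  -- `u` is invertible and `P` is separable exactly where `D` does not vanish
  let D : R₀ := Algebra.norm R₀ u * resultant P P.derivative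
  have hDv : ∀ {K : Type u} [Field K] [Algebra F K] (v : R₀ →ₐ[F] K), IsUnit (extMap A v u) →
      (∀ P : Polynomial K, P.Monic → aeval (extMap A v (u * s)) P = 0 →
          m ≤ P.natDegree ∧ (P.natDegree = m → P.Separable)) → IsUnit (v D) := by
    intro K _ _ v hvu hv
    rw [map_mul]
    refine (hN v hvu).isUnit.mul ?_
    refine (hP.isUnit_map_resultant_iff (v : R₀ →+* K)).2 ?_
    exact (hv _ (hP.map _) (hvP v)).2 (by rw [hP.natDegree_map, hPdeg])
  have hD0 : D ≠ 0 := fun h => (hDv v₀ hv₀u hv₀).ne_zero (by rw [h, map_zero])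
  let R := Localization.Away D
  let ι : R₀ →ₐ[F] R := IsScalarTower.toAlgHom F R₀ R
  have hD : IsUnit (ι D) := IsLocalization.Away.algebraMap_isUnit D
  have hND : IsUnit (ι (Algebra.norm R₀ u)) := by
    rw [map_mul] at hD
    exact isUnit_of_mul_isUnit_left hD
  have hrD : IsUnit (ι (resultant P P.derivative)) := by
    rw [map_mul] at hD
    exact isUnit_of_mul_isUnit_right hD
  have hjD : IsUnit (j D) := (map_ne_zero_iff j hj |>.2 hD0).isUnit
  let κ : R →ₐ[F] Q := IsLocalization.Away.liftAlgHom D hjD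
  have hκι : ∀ r, κ (ι r) = j r := fun r => IsLocalization.Away.lift_eq D hjD r
  have hκ : Function.Injective κ := by
    rw [injective_iff_map_eq_zero]
    intro z hz
    obtain ⟨n, a, ha⟩ := IsLocalization.Away.surj D z
    have ha' : z * ι D ^ n = ι a := ha
    have h1 := congrArg κ ha'
    rw [map_mul, hz, zero_mul, hκι, eq_comm, map_eq_zero_iff j hj] at h1
    rw [h1, map_zero] at ha'
    exact (hD.pow n).mul_left_eq_zero.1 ha'
  have : Nontrivial R := κ.toRingHom.domain_nontrivial
  -- a polynomial of degree less than `m` annihilating `u s` is divisible by the minimal polynomial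
  -- over the fraction field
  have hξ := isEtaleSubalgebra_and_hasType_adjoin hℓ h2 hm (R := R) (u := extMap A ι u)
    (s := extMap A ι s) (P := P.map (ι : R₀ →+* R))
    (by rwa [← isUnit_norm_iff, norm_extMap])
    (by rw [← extMap_lTensor, hu₁, map_zero]) (by rw [← extMap_lTensor, hs₂, map_zero])
    (hP.map _) (by rw [hP.natDegree_map, hPdeg])
    ((hP.isUnit_map_resultant_iff (ι : R₀ →+* R)).1 hrD)
    (by rw [← map_mul, ← extMap_aeval, hPy, map_zero])
    (by
      intro f hf h0
      rw [← map_mul] at h0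
      have h1 := congrArg (extMap A κ) h0
      rw [extMap_aeval, map_zero, ← extMap_comp] at h1
      have hcomp : κ.comp ι = j := AlgHom.ext hκι
      rw [hcomp] at h1
      by_contra hf0
      have hf0' : f.map (κ : R →+* Q) ≠ 0 :=
        (Polynomial.map_ne_zero_iff hκ).2 hf0
      have h3 := minpoly.degree_le_of_ne_zero Q _ hf0' h1
      have h4 : P.map (algebraMap R₀ Q) = minpoly Q (extMap A j (u * s)) := hPQ
      rw [← h4, hP.degree_map, degree_eq_natDegree hP.ne_zero, hPdeg] at h3
      exact absurd (h3.trans degree_map_le) (not_le.2 hf))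
  rw [← map_mul] at hξ
  refine ⟨d₁ + d₂, D, ⟨Algebra.adjoin R {extMap A ι (u * s)}, hξ.1, ?_⟩, ?_⟩
  · rw [htype]
    exact hξ.2
  · intro K _ _ _ p
    obtain ⟨v, hvu, hvp, hv⟩ := hspec K p
    let x : R →ₐ[F] K := IsLocalization.Away.liftAlgHom D (hDv v hvu hv)
    have hxι : x.comp ι = v := AlgHom.ext fun r => IsLocalization.Away.lift_eq D (hDv v hvu hv) r
    refine ⟨x, Subtype.ext ?_⟩
    rw [hvp, ← hxι, extMap_comp]
    exact extSubalgebra_adjoin_singleton x _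

end GenericPoint

/-! ### Rational curves -/

section RationalCurves

variable {F : Type u} [Field F]

/-- A point over `C` of a functor `P` defines a natural transformation to `P` from the functor
represented by `S(C)`, for a fully faithful contravariant functor `S`. -/
theorem exists_natTrans_of_fullyFaithful {D E : Type*} [Category.{u} D] [Category.{u} E]
    {S : Dᵒᵖ ⥤ E} (hS : S.FullyFaithful) {P : D ⥤ Type u} {C : D} (ζ : P.obj C) {X : E}
    (i : S.obj (Opposite.op C) ≅ X) :
    ∃ φ : S.rightOp ⋙ yoneda.obj X ⟶ P, ∀ (T : D) (c : C ⟶ T), ∃ g, φ.app T g = P.map c ζ := by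
  let τ : ∀ T : D, (S.obj (Opposite.op T) ⟶ X) → (C ⟶ T) :=
    fun T g => (hS.preimage (g ≫ i.inv)).unop
  refine ⟨{ app := fun T => TypeCat.ofHom fun g => P.map (τ T g) ζ, naturality := ?_ }, ?_⟩
  · intro T T' f
    ext g
    change P.map (τ T' (S.map f.op ≫ g)) ζ = P.map f (P.map (τ T g) ζ)
    have : τ T' (S.map f.op ≫ g) = τ T g ≫ f :=
      Quiver.Hom.op_inj (hS.map_injective (by simp [τ]))
    rw [← Functor.map_comp_apply, this]
  · intro T c
    refine ⟨S.map c.op ≫ i.hom, ?_⟩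
    have : τ T (S.map c.op ≫ i.hom) = c :=
      Quiver.Hom.op_inj (hS.map_injective (by simp [τ]))
    change P.map (τ T (S.map c.op ≫ i.hom)) ζ = _
    rw [this]

/-- Two specializations of a point over the coordinate ring of an affine open subscheme of the
projective line are elementarily linked: maps from `Spec C` to the space are points over `C`. -/
theorem elementarilyLinked_of_iso {P : CommAlgCat.{u} F ⥤ Type u} {C : CommAlgCat.{u} F}
    (ζ : P.obj C) {W : (projLine F).left.Opens}
    (i : (algSpec (CommRingCat.of F)).obj (Opposite.op C) ≅ openOver (projLine F) W)
    (a b : C ⟶ CommAlgCat.of F F) : ElementarilyLinked P (P.map a ζ) (P.map b ζ) := by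
  obtain ⟨φ, hφ⟩ := exists_natTrans_of_fullyFaithful algSpec.fullyFaithful ζ i
  obtain ⟨p, hp⟩ := hφ _ a
  obtain ⟨q, hq⟩ := hφ _ b
  exact ⟨W, φ, p, q, hp, hq⟩

attribute [local instance] MvPolynomial.gradedAlgebra

theorem elementarilyLinked_of_openImmersion {P : CommAlgCat.{u} F ⥤ Type u} {C : Type u}
    [CommRing C] [Algebra F C] (ζ : P.obj (CommAlgCat.of F C))
    (f : Spec (CommRingCat.of C) ⟶ (projLine F).left) [IsOpenImmersion f]
    (hf : f ≫ (projLine F).hom = Spec.map (CommRingCat.ofHom (algebraMap F C)))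
    (a b : C →ₐ[F] F) :
    ElementarilyLinked P (P.map (CommAlgCat.ofHom a) ζ) (P.map (CommAlgCat.ofHom b) ζ) := by
  refine elementarilyLinked_of_iso ζ (W := f.opensRange) (Over.isoMk f.isoOpensRange ?_) _ _
  change f.isoOpensRange.hom ≫ f.opensRange.ι ≫ (projLine F).hom = _
  rw [← Category.assoc, Scheme.Hom.isoOpensRange_hom_ι, hf]
  rfl

/-- Evaluation of the affine coordinate `X₁ / X₀` at a rational point. -/
theorem exists_eval_away
    (h₀ : (MvPolynomial.X 0 : MvPolynomial (Fin 2) F) ∈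
      MvPolynomial.homogeneousSubmodule (Fin 2) F 1)
    (h₁ : (MvPolynomial.X 1 : MvPolynomial (Fin 2) F) ∈
      MvPolynomial.homogeneousSubmodule (Fin 2) F (1 • 1)) (c : F) :
    ∃ ε : HomogeneousLocalization.Away (MvPolynomial.homogeneousSubmodule (Fin 2) F)
        (MvPolynomial.X 0) →+* F,
      ε (HomogeneousLocalization.Away.mk _ h₀ 1 (MvPolynomial.X 1) h₁) = c ∧
      ∀ r, ε (HomogeneousLocalization.fromZeroRingHom _ _ (algebraMap F _ r)) = r := by
  let ε₀ : MvPolynomial (Fin 2) F →+* F := MvPolynomial.eval ![1, c]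
  have h0 : IsUnit (ε₀ (MvPolynomial.X 0)) := by simp [ε₀]
  let ε₁ : Localization.Away (MvPolynomial.X 0 : MvPolynomial (Fin 2) F) →+* F :=
    IsLocalization.Away.lift (MvPolynomial.X 0) h0
  have hmk : ∀ x y, ε₀ y.1 = 1 → ε₁ (Localization.mk x y) = ε₀ x := fun x y hy => by
    rw [Localization.mk_eq_mk']
    refine (IsLocalization.lift_mk'_spec _ _ _ _).2 ?_
    rw [hy, one_mul]
  refine ⟨ε₁.comp (algebraMap _ (Localization _)), ?_, fun r => ?_⟩
  · refine (hmk _ _ ?_).trans ?_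
    · simp [ε₀]
    · simp [ε₀]
  · refine (hmk _ _ ?_).trans ?_
    · simp [ε₀]
    · exact MvPolynomial.eval_C r

/-- Two specializations of a point over a principal open subset of the affine line are elementarily
linked. -/
theorem elementarilyLinked_of_away {P : CommAlgCat.{u} F ⥤ Type u} {h : Polynomial F}
    (ζ : P.obj (CommAlgCat.of F (Localization.Away h))) (a b : Localization.Away h →ₐ[F] F) :
    ElementarilyLinked P (P.map (CommAlgCat.ofHom a) ζ) (P.map (CommAlgCat.ofHom b) ζ) := by
  let 𝒜 := MvPolynomial.homogeneousSubmodule (Fin 2) F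
  let X₀ : MvPolynomial (Fin 2) F := MvPolynomial.X 0
  have hX₀ : X₀ ∈ 𝒜 1 := MvPolynomial.isHomogeneous_X _ _
  have hX₁ : (MvPolynomial.X 1 : MvPolynomial (Fin 2) F) ∈ 𝒜 (1 • 1) :=
    MvPolynomial.isHomogeneous_X _ _
  let B := HomogeneousLocalization.Away 𝒜 X₀
  let _ : Algebra F B :=
    ((HomogeneousLocalization.fromZeroRingHom 𝒜 (Submonoid.powers X₀)).comp
      (algebraMap F (𝒜 0))).toAlgebra
  -- the affine coordinate `X₁ / X₀`, and the function `h` in it on the standard affine chart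
  let t : B := HomogeneousLocalization.Away.mk 𝒜 hX₀ 1 (MvPolynomial.X 1) hX₁
  let h' : B := Polynomial.aeval t h
  let C := Localization.Away h'
  have hev : ∀ c : F, ∃ ε : B →ₐ[F] F, ε t = c := by
    intro c
    obtain ⟨ε, hε, hεF⟩ := exists_eval_away hX₀ hX₁ c
    exact ⟨{ ε with commutes' := hεF }, hε⟩
  have hg : IsUnit ((IsScalarTower.toAlgHom F B C).comp (Polynomial.aeval t) h) :=
    IsLocalization.Away.algebraMap_isUnit h'
  let g : Localization.Away h →ₐ[F] C := IsLocalization.Away.liftAlgHom h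
    (f := (IsScalarTower.toAlgHom F B C).comp (Polynomial.aeval t))
    hg
  have hlift : ∀ e : Localization.Away h →ₐ[F] F, ∃ e' : C →ₐ[F] F, e'.comp g = e := by
    intro e
    obtain ⟨ε, hε⟩ := hev (e (algebraMap (Polynomial F) _ Polynomial.X))
    have hcomp : ε.comp (Polynomial.aeval t) =
        e.comp (IsScalarTower.toAlgHom F (Polynomial F) (Localization.Away h)) :=
      Polynomial.algHom_ext (by simp [hε])
    have hh : IsUnit (ε h') := by
      have : ε h' = e (algebraMap _ _ h) := DFunLike.congr_fun hcomp h
      rw [this]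
      exact (IsLocalization.Away.algebraMap_isUnit h).map e
    let e' : C →ₐ[F] F := IsLocalization.Away.liftAlgHom h' hh
    refine ⟨e', IsLocalization.algHom_ext (Submonoid.powers h) (Polynomial.algHom_ext ?_)⟩
    change e' (g (algebraMap _ _ Polynomial.X)) = e (algebraMap _ _ Polynomial.X)
    have h1 : g (algebraMap _ _ Polynomial.X) = algebraMap B C (Polynomial.aeval t Polynomial.X) :=
      IsLocalization.Away.lift_eq h hg Polynomial.X
    have h2 : ∀ x, e' (algebraMap B C x) = ε x := fun x => IsLocalization.Away.lift_eq h' hh x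
    rw [h1, h2, Polynomial.aeval_X, hε]
  obtain ⟨a', ha⟩ := hlift a
  obtain ⟨b', hb⟩ := hlift b
  let f : Spec (CommRingCat.of C) ⟶ (projLine F).left :=
    Spec.map (CommRingCat.ofHom (algebraMap B C)) ≫
      Proj.awayι 𝒜 X₀ hX₀ one_pos
  have hfo : IsOpenImmersion f := by
    have h₁ : IsOpenImmersion (Spec.map (CommRingCat.ofHom (algebraMap B C))) :=
      IsOpenImmersion.of_isLocalization h'
    have h₂ : IsOpenImmersion (Proj.awayι (MvPolynomial.homogeneousSubmodule (Fin 2) F)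
      (MvPolynomial.X 0) hX₀ one_pos) := inferInstance
    exact @IsOpenImmersion.comp _ _ _ _ _ h₁ h₂
  have hf : f ≫ (projLine F).hom = Spec.map (CommRingCat.ofHom (algebraMap F C)) := by
    change (Spec.map (CommRingCat.ofHom (algebraMap B C)) ≫ Proj.awayι 𝒜 X₀ hX₀ one_pos) ≫
      Proj.toSpecZero 𝒜 ≫ Spec.map (CommRingCat.ofHom (algebraMap F (𝒜 0))) = _
    rw [Category.assoc, Proj.awayι_toSpecZero_assoc, ← Spec.map_comp, ← Spec.map_comp]
    rfl
  have key := elementarilyLinked_of_openImmersion (P.map (CommAlgCat.ofHom g) ζ) f hf a' b'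
  rw [← Functor.map_comp_apply, ← Functor.map_comp_apply] at key
  rw [← ha, ← hb]
  exact key

end RationalCurves

/-! ### R-triviality of parametrized spaces -/

section Parametrized

variable {F : Type u} [Field F]

/-- The ideal of the complement of an open subspace, tested by points over fields. -/
theorem IsOpenSubfunctor.exists_ideal {P : CommAlgCat.{u} F ⥤ Type u} {U : Subfunctor P}
    (hU : IsOpenSubfunctor U) {R : Type u} [CommRing R] [Algebra F R]
    (ξ : P.obj (CommAlgCat.of F R)) :
    ∃ I : Ideal R, (∀ (S : Type u) [CommRing S] [Algebra F S] (f : R →ₐ[F] S),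
        (∃ i ∈ I, IsUnit (f i)) → P.map (CommAlgCat.ofHom f) ξ ∈ U.obj (CommAlgCat.of F S)) ∧
      ∀ (K : Type u) [Field K] [Algebra F K] (x : R →ₐ[F] K),
        P.map (CommAlgCat.ofHom x) ξ ∈ U.obj (CommAlgCat.of F K) → ∃ i ∈ I, x i ≠ 0 := by
  obtain ⟨I, hI⟩ := hU (CommAlgCat.of F R) ξ
  refine ⟨I, fun S _ _ f hf => ?_, fun K _ _ x hx => ?_⟩
  · obtain ⟨i, hi, hfi⟩ := hf
    exact (hI (CommAlgCat.of F S) (CommAlgCat.ofHom f)).2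
      (Ideal.eq_top_of_isUnit_mem _ (Ideal.mem_map_of_mem _ hi) hfi)
  · have h : I.map (x : R →+* K) = ⊤ := (hI (CommAlgCat.of F K) (CommAlgCat.ofHom x)).1 hx
    by_contra! h0
    have : I.map (x : R →+* K) ≤ ⊥ := Ideal.map_le_iff_le_comap.2 fun i hi => h0 i hi
    exact bot_ne_top (le_antisymm bot_le (h ▸ this))

/-- An open subspace contains two rational points of a parametrized space together with an open
piece of the line joining their parameters. -/
theorem elementarilyLinked_of_parametrization {P : CommAlgCat.{u} F ⥤ Type u} {d : ℕ}
    {D : MvPolynomial (Fin d) F} (ξ : P.obj (CommAlgCat.of F (Localization.Away D)))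
    {U : Subfunctor P} (hU : IsOpenSubfunctor U) (x y : Localization.Away D →ₐ[F] F)
    (hx : P.map (CommAlgCat.ofHom x) ξ ∈ U.obj (CommAlgCat.of F F))
    (hy : P.map (CommAlgCat.ofHom y) ξ ∈ U.obj (CommAlgCat.of F F)) :
    ElementarilyLinked U.toFunctor ⟨P.map (CommAlgCat.ofHom x) ξ, hx⟩
      ⟨P.map (CommAlgCat.ofHom y) ξ, hy⟩ := by
  obtain ⟨I, hI, hIK⟩ := hU.exists_ideal ξ
  -- a function in the ideal of the complement of `U` which vanishes at none of the two points
  obtain ⟨i, hi, hix, hiy⟩ : ∃ i ∈ I, x i ≠ 0 ∧ y i ≠ 0 := by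
    obtain ⟨i, hi, hix⟩ := hIK F x hx
    obtain ⟨k, hk, hky⟩ := hIK F y hy
    by_cases h1 : y i = 0
    · by_cases h2 : x k = 0
      · refine ⟨i + k, I.add_mem hi hk, ?_, ?_⟩
        · rwa [map_add, h2, add_zero]
        · rwa [map_add, h1, zero_add]
      · exact ⟨k, hk, h2, hky⟩
    · exact ⟨i, hi, hix, h1⟩
  obtain ⟨n, q, hq⟩ := IsLocalization.Away.surj D i
  let ι := IsScalarTower.toAlgHom F (MvPolynomial (Fin d) F) (Localization.Away D)
  have hq' : i * ι D ^ n = ι q := hq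
  have hD : IsUnit (ι D) := IsLocalization.Away.algebraMap_isUnit D
  have hqI : ι q ∈ I := hq' ▸ I.mul_mem_right _ hi
  -- the line through the parameters of the two points, with the first at `0`, the second at `1`
  let θ : MvPolynomial (Fin d) F →ₐ[F] Polynomial F := MvPolynomial.aeval fun k =>
    Polynomial.C (x (ι (MvPolynomial.X k))) +
      Polynomial.C (y (ι (MvPolynomial.X k)) - x (ι (MvPolynomial.X k))) * Polynomial.X
  let h := θ (q * D)
  have h0 : ∀ f, (θ f).eval 0 = x (ι f) := fun f => by
    have : (Polynomial.aeval (0 : F)).comp θ = x.comp ι :=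
      MvPolynomial.algHom_ext fun k => by simp [θ]
    exact DFunLike.congr_fun this f
  have h1 : ∀ f, (θ f).eval 1 = y (ι f) := fun f => by
    have : (Polynomial.aeval (1 : F)).comp θ = y.comp ι :=
      MvPolynomial.algHom_ext fun k => by simp [θ]
    exact DFunLike.congr_fun this f
  have hh0 : IsUnit (Polynomial.aeval (0 : F) h) := by
    change IsUnit ((θ (q * D)).eval 0)
    rw [h0, map_mul, map_mul, ← hq', map_mul]
    exact ((hix.isUnit.mul ((hD.pow n).map x)).mul (hD.map x))
  have hh1 : IsUnit (Polynomial.aeval (1 : F) h) := by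
    change IsUnit ((θ (q * D)).eval 1)
    rw [h1, map_mul, map_mul, ← hq', map_mul]
    exact ((hiy.isUnit.mul ((hD.pow n).map y)).mul (hD.map y))
  let C := Localization.Away h
  let κ := IsScalarTower.toAlgHom F (Polynomial F) C
  have hκ : IsUnit (κ (θ q) * κ (θ D)) := by
    rw [← map_mul, ← map_mul]
    exact IsLocalization.Away.algebraMap_isUnit h
  have hκD : IsUnit ((κ.comp θ) D) := isUnit_of_mul_isUnit_right hκ
  have hκq : IsUnit ((κ.comp θ) q) := isUnit_of_mul_isUnit_left hκ
  let g : Localization.Away D →ₐ[F] C := IsLocalization.Away.liftAlgHom D hκD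
  have hg : ∀ f, g (ι f) = κ (θ f) := fun f => IsLocalization.Away.lift_eq D hκD f
  have hgU : P.map (CommAlgCat.ofHom g) ξ ∈ U.obj (CommAlgCat.of F C) := by
    refine hI C g ⟨ι q, hqI, ?_⟩
    change IsUnit (g (ι q))
    rw [hg]
    exact hκq
  let e₀ : C →ₐ[F] F := IsLocalization.Away.liftAlgHom h hh0
  let e₁ : C →ₐ[F] F := IsLocalization.Away.liftAlgHom h hh1
  have he₀ : e₀.comp g = x :=
    IsLocalization.algHom_ext (Submonoid.powers D) (AlgHom.ext fun f => by
      change e₀ (g (ι f)) = x (ι f)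
      rw [hg, ← h0]
      exact IsLocalization.Away.lift_eq h hh0 (θ f))
  have he₁ : e₁.comp g = y :=
    IsLocalization.algHom_ext (Submonoid.powers D) (AlgHom.ext fun f => by
      change e₁ (g (ι f)) = y (ι f)
      rw [hg, ← h1]
      exact IsLocalization.Away.lift_eq h hh1 (θ f))
  have key := elementarilyLinked_of_away (P := U.toFunctor) (h := h)
    ⟨P.map (CommAlgCat.ofHom g) ξ, hgU⟩ e₀ e₁
  have hx' : (⟨P.map (CommAlgCat.ofHom x) ξ, hx⟩ : U.toFunctor.obj (CommAlgCat.of F F)) =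
      U.toFunctor.map (CommAlgCat.ofHom e₀) ⟨P.map (CommAlgCat.ofHom g) ξ, hgU⟩ := by
    refine Subtype.ext ?_
    change _ = P.map (CommAlgCat.ofHom e₀) (P.map (CommAlgCat.ofHom g) ξ)
    rw [← Functor.map_comp_apply, ← CommAlgCat.ofHom_comp, he₀]
  have hy' : (⟨P.map (CommAlgCat.ofHom y) ξ, hy⟩ : U.toFunctor.obj (CommAlgCat.of F F)) =
      U.toFunctor.map (CommAlgCat.ofHom e₁) ⟨P.map (CommAlgCat.ofHom g) ξ, hgU⟩ := by
    refine Subtype.ext ?_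
    change _ = P.map (CommAlgCat.ofHom e₁) (P.map (CommAlgCat.ofHom g) ξ)
    rw [← Functor.map_comp_apply, ← CommAlgCat.ofHom_comp, he₁]
  rw [hx', hy']
  exact key

/-- If a family over a principal open subset of an affine space contains all points of a space over
infinite fields, every nonempty open subspace of this space is R-trivial. -/
theorem isRTrivial_of_parametrization [Infinite F] {P : CommAlgCat.{u} F ⥤ Type u} {d : ℕ}
    {D : MvPolynomial (Fin d) F} (ξ : P.obj (CommAlgCat.of F (Localization.Away D)))
    (hξ : ∀ (K : Type u) [Field K] [Infinite K] [Algebra F K] (p : P.obj (CommAlgCat.of F K)),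
      ∃ x : Localization.Away D →ₐ[F] K, P.map (CommAlgCat.ofHom x) ξ = p)
    {U : Subfunctor P} (hU : IsOpenSubfunctor U) (hne : IsNonemptySpace U.toFunctor) :
    IsRTrivial U.toFunctor := by
  refine Nat.card_eq_one_iff_unique.2 ⟨⟨?_⟩, ?_⟩
  · rintro ⟨p, hp⟩ ⟨q, hq⟩
    obtain ⟨x, rfl⟩ := hξ F p
    obtain ⟨y, rfl⟩ := hξ F q
    exact Quot.sound (elementarilyLinked_of_parametrization ξ hU x y hp hq)
  · obtain ⟨S, hS, ⟨p, hp⟩⟩ := hne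
    obtain ⟨M, hM⟩ := Ideal.exists_maximal S
    let _ : Field (S ⧸ M) := Ideal.Quotient.field M
    have : Infinite (S ⧸ M) := Infinite.of_injective _ (algebraMap F (S ⧸ M)).injective
    have hp' := U.map (CommAlgCat.ofHom (Ideal.Quotient.mkₐ F M)) hp
    obtain ⟨x, hx⟩ := hξ (S ⧸ M) (P.map (CommAlgCat.ofHom (Ideal.Quotient.mkₐ F M)) p)
    obtain ⟨I, hI, hIK⟩ := hU.exists_ideal ξ
    have hxU : P.map (CommAlgCat.ofHom x) ξ ∈ U.obj (CommAlgCat.of F (S ⧸ M)) := by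
      rw [hx]
      exact hp'
    obtain ⟨i, hi, hix⟩ := hIK (S ⧸ M) x hxU
    obtain ⟨n, q, hq⟩ := IsLocalization.Away.surj D i
    let ι := IsScalarTower.toAlgHom F (MvPolynomial (Fin d) F) (Localization.Away D)
    have hq' : i * ι D ^ n = ι q := hq
    have hD : IsUnit (ι D) := IsLocalization.Away.algebraMap_isUnit D
    have hqD : q * D ≠ 0 := by
      intro h0
      have h1 := congrArg (fun f => x (ι f)) h0
      simp only [map_mul, map_zero, ← hq'] at h1
      refine mul_ne_zero (mul_ne_zero hix ?_) ?_ h1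
      · rw [map_pow]
        exact pow_ne_zero _ (hD.map x).ne_zero
      · exact (hD.map x).ne_zero
    obtain ⟨v, hv⟩ : ∃ v : Fin d → F, MvPolynomial.aeval v (q * D) ≠ 0 := by
      by_contra! h0
      exact hqD (MvPolynomial.funext fun v => by simpa [MvPolynomial.aeval_eq_eval] using h0 v)
    rw [map_mul] at hv
    have hvD : IsUnit (MvPolynomial.aeval v D) := (right_ne_zero_of_mul hv).isUnit
    let y : Localization.Away D →ₐ[F] F := IsLocalization.Away.liftAlgHom D hvD
    have hy : ∀ f, y (ι f) = MvPolynomial.aeval v f := fun f =>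
      IsLocalization.Away.lift_eq D hvD f
    have hyU : P.map (CommAlgCat.ofHom y) ξ ∈ U.obj (CommAlgCat.of F F) := by
      refine hI F y ⟨ι q, hq' ▸ I.mul_mem_right _ hi, ?_⟩
      rw [hy]
      exact (left_ne_zero_of_mul hv).isUnit
    exact ⟨Quot.mk _ ⟨_, hyU⟩⟩

end Parametrized

/-! ### Open subspaces of the moduli space -/

/-- A nonsplit central simple algebra has an infinite base field: a finite division algebra is
commutative. -/
theorem infinite_of_not_isSplitAlgebra {F : Type*} [Field F] {A : Type*} [Ring A] [Algebra F A]
    [FiniteDimensional F A] [Algebra.IsCentral F A] [IsSimpleRing A] (h : ¬ IsSplitAlgebra F A) :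
    Infinite F := by
  by_contra hfin
  rw [not_infinite_iff_finite] at hfin
  refine h ?_
  have := IsArtinianRing.of_finite F A
  obtain ⟨n, hn, D, _, _, _, ⟨e⟩⟩ := IsSimpleRing.exists_algEquiv_matrix_divisionRing_finite F A
  have : Finite D := Module.finite_of_finite F
  have hcomm : ∀ x y : D, x * y = y * x := (littleWedderburn D).mul_comm
  have : Nonempty (Fin n) := ⟨⟨0, Nat.pos_of_ne_zero hn.out⟩⟩
  have hbij : Function.Bijective (Algebra.ofId F D) := by
    refine ⟨(algebraMap F D).injective, fun x => ?_⟩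
    have hx : e.symm (Matrix.scalar (Fin n) x) ∈ Subalgebra.center F A := by
      rw [Subalgebra.mem_center_iff]
      intro a
      apply e.injective
      rw [map_mul, map_mul, e.apply_symm_apply]
      exact ((Matrix.scalar_commute x (hcomm x) (e a)).eq).symm
    obtain ⟨c, hc⟩ := Algebra.IsCentral.out hx
    refine ⟨c, ?_⟩
    have hc' : algebraMap F A c = e.symm (Matrix.scalar (Fin n) x) := hc
    have h1 := congrArg e hc'
    rw [e.apply_symm_apply, AlgEquiv.commutes] at h1
    exact Matrix.scalar_inj.1 h1
  exact ⟨n, hn.out, ⟨e.trans (AlgEquiv.ofBijective _ hbij).symm.mapMatrix⟩⟩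

theorem mainTheorem7 (F : Type u) [Field F] (hchar : ringChar F ≠ 2)
    (A : Type u) [Ring A] [Algebra F A] [FiniteDimensional F A]
    [Algebra.IsCentral F A] [IsSimpleRing A]
    (hexp : HasExponentTwo F A) (m : ℕ) (hdeg : csaDegree F A = 2 * m)
    (U : Subfunctor (et F A m)) (hopen : IsOpenSubfunctor U)
    (hne : IsNonemptySpace U.toFunctor) :
    IsRTrivial U.toFunctor := by
  have h2 : (2 : F) ≠ 0 := Ring.two_ne_zero hchar
  have : Infinite F := infinite_of_not_isSplitAlgebra hexp.1
  have hm : m ≠ 0 := by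
    rintro rfl
    have h1 : 1 * 1 ≤ Module.finrank F A := Module.finrank_pos
    have h3 := Nat.le_sqrt.2 h1
    rw [csaDegree] at hdeg
    omega
  obtain ⟨S, hS, ⟨p, hp⟩⟩ := id hne
  obtain ⟨M, hM⟩ := Ideal.exists_maximal S
  let _ : Field (S ⧸ M) := Ideal.Quotient.field M
  have : Infinite (S ⧸ M) := Infinite.of_injective _ (algebraMap F (S ⧸ M)).injective
  obtain ⟨d, D, ξ, hξ⟩ := exists_generic_point h2 hexp.2 hdeg hm
    ((et F A m).map (CommAlgCat.ofHom (Ideal.Quotient.mkₐ F M)) p)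
  exact isRTrivial_of_parametrization ξ hξ hopen hne
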